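/- **Setting.** Composition is written in diagrammatic order: $fg$ is $f$ followed by $g$. Let $\mathscr X$ be a tangent category, i.e. a category with an endofunctor $T$ and, for each object $M$, a commutative monoid $(TM,p_M,+_M,0_M)$ in the slice $\mathscr X/M$ whose finite fibre powers $T_nM$ are preserved by all $T^k$, such that $p,+,0$ are natural, together with a vertical lift $\ell:T\Rightarrow T^2$ and a canonical flip $c:T^2\Rightarrow T^2$ satisfying the usual axioms, including universality of the vertical lift. A limit is *tangential* if it is preserved by every $T^k$, $k\in\mathbb N$. A *differential bundle* $\underline E=(E,q,\sigma,\zeta,\lambda)$ over $M$ is a commutative monoid $(E,q,\sigma,\zeta)$ in $\mathscr X/M$ (with specified finite fibre powers, all tangential) and a lift $\lambda:E\to TE$ such that $(\lambda,0_M):\underline E\to T\underline E$ and $(\lambda,\zeta):\underline E\to\underline TE$ are additive, $\lambda\ell_E=\lambda T(\lambda)$, and $\mu=\langle\pi_1\lambda,\pi_20_E\rangle T(\sigma):E\times_ME\to TE$ presents $E\times_ME$ as a tangential pullback of $T(q)$ along $0_M$. A *linear morphism* $(g,f):(E,q,\sigma,\zeta,\lambda)\to(F,r,\sigma',\zeta',\lambda')$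 of differential bundles over $M$ and $N$ is a pair $g:E\to F$, $f:M\to N$ with $qf=gr$ and $\lambda T(g)=g\lambda'$. These morphisms form a category $\mathrm{DBun}$, with a functor $\mathsf{cod}:\mathrm{DBun}\to\mathscr X$ taking bases. The bundles over $M$, with the morphisms $(g,1_M)$, form a category $\mathrm{DBun}_M$, whose hom-sets are commutative monoids under pointwise addition. Biproducts and products of differential bundles over $M$ are taken in $\mathrm{DBun}_M$. The tangent bundle $\underline TM=(TM,p_M,+_M,0_M,\ell_M)$ is a differential bundle over $M$, and each $\underline E$ over $M$ yields a differential bundle $T\underline E=(TE,T(q),T(\sigma),T(\zeta),T(\lambda)c_E)$ over $TM$. A pullback of $\underline E$ along $f$ is a differential bundle with a $\mathsf{cod}$-cartesian arrow over $f$ to $\underline E$. For a product $\underline F=\prod_{i\in I}\underline{E_i}$ in $\mathrm{DBun}_M$ with projections $\pi_i$, where $\underline{E_j}$ has projection $q_j:E_j\to M$, a differential bundle $\underline P$ over $E_j$ is the *$j$-th partial bundle* of $\underline F$ if its underlying morphism is $\pi_j:F\to E_j$ and the canonical projection $F\to\prod_{i\ne j}E_i$ together with $q_j$ is a cartesian arrow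 $\underline P\to\prod_{i\neq j}\underline{E_i}$ in $\mathrm{DBun}$. A *vertical connection* on $\underline TM$ is a morphism $K:T^2M\to TM$ with $\ell_MK=1$ such that $(K,p_M):T(\underline TM)\to\underline TM$ and $(K,p_M):\underline T(TM)\to\underline TM$ are linear. A *horizontal connection* is a section $H:TM\times_MTM\to T^2M$ of $U=\langle p_{TM},T(p_M)\rangle$ such that $(H,1)$ is linear from $p_M^*(\underline TM)$ (with underlying morphism $\pi_1$) to $\underline T(TM)$ and from $p_M^*(\underline TM)$ (with underlying morphism $\pi_2$) to $T(\underline TM)$. An *affine connection* on $M$ is a pair $(K,H)$ of a vertical and a horizontal connection on $\underline TM$ with $HK=\pi_1p_M0_M$ and $\langle K,p_{TM}\rangle\mu+UH=1_{T^2M}$, where $\mu$ is that of $\underline TM$ and the sum is taken in $\underline T(TM)$. **Theorem.** Let $M$ be an object of an arbitrary tangent category $\mathscr X$. The assignment $(K,H)\mapsto K$ is a bijection from the set of affine connections on $M$ to each of the following sets of morphisms. 1. The morphisms $K:T^2M\to TM$ such that $T^2M$ underlies a biproduct of differential bundles $\underline TM\oplus_M\underline TM\oplus_M\underline TM$ over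 $M$ whose third projection is $K$, whose third injection is $\ell_M:TM\to T^2M$, and whose first and second partial bundles are $\underline T(TM)$ and $T(\underline TM)$, respectively. 2. The retractions $K:T^2M\to TM$ of $\ell_M$ such that $T^2M$ underlies a product of differential bundles $\underline TM\times_M\underline TM\times_M\underline TM$ over $M$ whose third projection is $K$ and whose first and second partial bundles are $\underline T(TM)$ and $T(\underline TM)$, respectively. 3. The effective vertical connections on $\underline TM$, i.e. the vertical connections $K:T^2M\to TM$ such that $p_{TM},T(p_M),K:T^2M\to TM$ present $T^2M$ as a fibre product over $M$ of three instances of $p_M:TM\to M$. -/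

import Mathlib

open CategoryTheory CategoryTheory.Limits

universe v u w

namespace TangentCat

section FibreProducts

variable {X : Type u} [Category.{v} X]

/-- A fibre product over `M` of the family `f i : B i ⟶ M` : a product of the objects `(B i, f i)`
in the slice category over `M`, with underlying object `(P, b)` and projections `π i`. -/
def IsFibreProduct {I : Type w} {M P : X} {B : I → X} (f : ∀ i, B i ⟶ M) (b : P ⟶ M)
    (π : ∀ i, P ⟶ B i) : Prop :=
  ∃ h : ∀ i, π i ≫ f i = b,
    Nonempty (IsLimit (Fan.mk (Over.mk b)
      fun i => (Over.homMk (π i) (h i) : Over.mk b ⟶ Over.mk (f i))))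

theorem isFibreProduct_iff {I : Type w} {M P : X} {B : I → X} (f : ∀ i, B i ⟶ M) (b : P ⟶ M)
    (π : ∀ i, P ⟶ B i) :
    IsFibreProduct f b π ↔ (∀ i, π i ≫ f i = b) ∧
      ∀ (A : X) (a : A ⟶ M) (g : ∀ i, A ⟶ B i), (∀ i, g i ≫ f i = a) →
        ∃! x : A ⟶ P, x ≫ b = a ∧ ∀ i, x ≫ π i = g i := by
  constructor
  · rintro ⟨h, ⟨hl⟩⟩
    refine ⟨h, fun A a g hg => ?_⟩
    let t : Fan (fun i => Over.mk (f i)) :=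
      Fan.mk (Over.mk a) fun i => (Over.homMk (g i) (hg i) : Over.mk a ⟶ Over.mk (f i))
    refine ⟨(hl.lift t).left, ⟨Over.w (hl.lift t), fun i => ?_⟩, ?_⟩
    · exact congrArg CommaMorphism.left (hl.fac t ⟨i⟩)
    · rintro y ⟨hy, hy'⟩
      have := hl.uniq t (Over.homMk y hy) (by
        rintro ⟨i⟩
        ext
        exact hy' i)
      exact congrArg CommaMorphism.left this
  · rintro ⟨h, hu⟩
    refine ⟨h, ⟨?_⟩⟩
    choose x hx hx' using fun (s : Fan (fun i => Over.mk (f i))) =>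
      hu s.pt.left s.pt.hom (fun i => (s.proj i).left) (fun i => Over.w (s.proj i))
    refine { lift := fun s => Over.homMk (x s) (hx s).1, fac := ?_, uniq := ?_ }
    · rintro s ⟨i⟩
      ext
      exact (hx s).2 i
    · intro s m hm
      ext
      refine hx' s m.left ⟨Over.w m, fun i => ?_⟩
      exact congrArg CommaMorphism.left (hm ⟨i⟩)

/-- A specified `n`-th fibre power of `q`. -/
structure FibrePower {E M : X} (q : E ⟶ M) (n : ℕ) where
  obj : X
  base : obj ⟶ M
  proj : Fin n → (obj ⟶ E)
  isFibreProduct : IsFibreProduct (fun _ : Fin n => q) base proj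

namespace FibrePower

variable {E M A : X} {q : E ⟶ M} {n : ℕ}

theorem proj_comp (P : FibrePower q n) (i : Fin n) : P.proj i ≫ q = P.base :=
  P.isFibreProduct.choose i

theorem proj_comp_eq (P : FibrePower q n) (i j : Fin n) : P.proj i ≫ q = P.proj j ≫ q := by
  rw [proj_comp, proj_comp]

theorem hom_ext (P : FibrePower q n) (i : Fin n) {x y : A ⟶ P.obj}
    (h : ∀ j, x ≫ P.proj j = y ≫ P.proj j) : x = y := by
  refine (((isFibreProduct_iff _ _ _).1 P.isFibreProduct).2 A (x ≫ P.base)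
    (fun j => x ≫ P.proj j) (fun j => ?_)).unique ⟨rfl, fun _ => rfl⟩ ⟨?_, fun j => (h j).symm⟩
  · rw [Category.assoc, proj_comp]
  · rw [← P.proj_comp i, ← Category.assoc, ← Category.assoc, h i]

theorem exists_pair (P : FibrePower q 2) (f g : A ⟶ E) (h : f ≫ q = g ≫ q) :
    ∃ x : A ⟶ P.obj, x ≫ P.proj 0 = f ∧ x ≫ P.proj 1 = g := by
  obtain ⟨x, ⟨_, hx⟩, _⟩ := ((isFibreProduct_iff _ _ _).1 P.isFibreProduct).2 A (f ≫ q) ![f, g]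
    (by intro i; fin_cases i <;> simp [h])
  exact ⟨x, hx 0, hx 1⟩

theorem exists_triple (P : FibrePower q 3) (f g k : A ⟶ E) (h : f ≫ q = g ≫ q)
    (h' : g ≫ q = k ≫ q) :
    ∃ x : A ⟶ P.obj, x ≫ P.proj 0 = f ∧ x ≫ P.proj 1 = g ∧ x ≫ P.proj 2 = k := by
  obtain ⟨x, ⟨_, hx⟩, _⟩ := ((isFibreProduct_iff _ _ _).1 P.isFibreProduct).2 A (f ≫ q) ![f, g, k]
    (by intro i; fin_cases i <;> simp [h, h'])
  exact ⟨x, hx 0, hx 1, hx 2⟩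

/-- The morphism `⟨f, g⟩` into a second fibre power. -/
noncomputable def pair (P : FibrePower q 2) (f g : A ⟶ E) (h : f ≫ q = g ≫ q) : A ⟶ P.obj :=
  (P.exists_pair f g h).choose

@[simp]
theorem pair_fst (P : FibrePower q 2) (f g : A ⟶ E) (h : f ≫ q = g ≫ q) :
    P.pair f g h ≫ P.proj 0 = f :=
  (P.exists_pair f g h).choose_spec.1

@[simp]
theorem pair_snd (P : FibrePower q 2) (f g : A ⟶ E) (h : f ≫ q = g ≫ q) :
    P.pair f g h ≫ P.proj 1 = g :=
  (P.exists_pair f g h).choose_spec.2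

theorem pair_ext (P : FibrePower q 2) {x y : A ⟶ P.obj} (h₀ : x ≫ P.proj 0 = y ≫ P.proj 0)
    (h₁ : x ≫ P.proj 1 = y ≫ P.proj 1) : x = y :=
  P.hom_ext 0 (fun j => by fin_cases j; exacts [h₀, h₁])

theorem comp_pair (P : FibrePower q 2) {B : X} (x : B ⟶ A) (f g : A ⟶ E) (h : f ≫ q = g ≫ q) :
    x ≫ P.pair f g h = P.pair (x ≫ f) (x ≫ g) (by simp [h]) :=
  P.pair_ext (by simp) (by simp)

theorem isPullback (P : FibrePower q 2) : IsPullback (P.proj 0) (P.proj 1) q q :=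
  ⟨⟨P.proj_comp_eq 0 1⟩, ⟨PullbackCone.IsLimit.mk _
    (fun s => P.pair s.fst s.snd s.condition) (fun s => by simp) (fun s => by simp)
    (fun s m h₀ h₁ => P.pair_ext (by simp [h₀]) (by simp [h₁]))⟩⟩

end FibrePower

end FibreProducts

section AdditiveBundles

variable {X : Type u} [Category.{v} X]

/-- The operations of a commutative monoid in the slice over `M`, with specified fibre powers. -/
structure AdditiveBundleData {E M : X} (q : E ⟶ M) where
  pow : ∀ n : ℕ, FibrePower q n
  add : (pow 2).obj ⟶ E
  zero : M ⟶ E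
  add_comp : add ≫ q = (pow 2).base
  zero_comp : zero ≫ q = 𝟙 M

namespace AdditiveBundleData

variable {E M A B : X} {q : E ⟶ M}

/-- The sum `f + g` of two generalized elements with a common image in `M`. -/
noncomputable def sum (S : AdditiveBundleData q) (f g : A ⟶ E) (h : f ≫ q = g ≫ q) : A ⟶ E :=
  (S.pow 2).pair f g h ≫ S.add

theorem sum_comp (S : AdditiveBundleData q) (f g : A ⟶ E) (h : f ≫ q = g ≫ q) :
    S.sum f g h ≫ q = f ≫ q := by
  rw [sum, Category.assoc, S.add_comp, ← (S.pow 2).proj_comp 0, ← Category.assoc,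
    FibrePower.pair_fst]

theorem comp_sum (S : AdditiveBundleData q) (x : B ⟶ A) (f g : A ⟶ E) (h : f ≫ q = g ≫ q) :
    x ≫ S.sum f g h = S.sum (x ≫ f) (x ≫ g) (by simp [h]) := by
  rw [sum, ← Category.assoc, FibrePower.comp_pair, sum]

theorem sum_congr (S : AdditiveBundleData q) {f g f' g' : A ⟶ E} (h : f ≫ q = g ≫ q)
    (hf : f = f') (hg : g = g') : S.sum f g h = S.sum f' g' (by rw [← hf, ← hg, h]) := by
  subst hf hg; rfl

end AdditiveBundleData

/-- An additive bundle over `M`, i.e. a commutative monoid in the slice category over `M`. -/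
structure AdditiveBundle {E M : X} (q : E ⟶ M) extends AdditiveBundleData q where
  add_comm' : toAdditiveBundleData.sum ((pow 2).proj 1) ((pow 2).proj 0)
    ((pow 2).proj_comp_eq 1 0) = add
  zero_add' : toAdditiveBundleData.sum (q ≫ zero) (𝟙 E) (by simp [zero_comp]) = 𝟙 E
  add_assoc' :
    toAdditiveBundleData.sum
      (toAdditiveBundleData.sum ((pow 3).proj 0) ((pow 3).proj 1) ((pow 3).proj_comp_eq 0 1))
      ((pow 3).proj 2)
      ((toAdditiveBundleData.sum_comp _ _ _).trans ((pow 3).proj_comp_eq 0 2)) =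
    toAdditiveBundleData.sum ((pow 3).proj 0)
      (toAdditiveBundleData.sum ((pow 3).proj 1) ((pow 3).proj 2) ((pow 3).proj_comp_eq 1 2))
      (((pow 3).proj_comp_eq 0 1).trans (toAdditiveBundleData.sum_comp _ _ _).symm)

namespace AdditiveBundle

variable {E M A : X} {q : E ⟶ M}

theorem sum_comm (S : AdditiveBundle q) (f g : A ⟶ E) (h : f ≫ q = g ≫ q) :
    S.sum f g h = S.sum g f h.symm := by
  conv_lhs => rw [AdditiveBundleData.sum, ← S.add_comm', AdditiveBundleData.comp_sum]
  exact S.sum_congr _ (by simp) (by simp)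

theorem zero_sum (S : AdditiveBundle q) (f : A ⟶ E) :
    S.sum (f ≫ q ≫ S.zero) f (by simp [S.zero_comp]) = f := by
  refine Eq.trans (S.sum_congr _ rfl (Category.comp_id f).symm) ?_
  refine (S.comp_sum f (q ≫ S.zero) (𝟙 E) (by simp [S.zero_comp])).symm.trans ?_
  rw [S.zero_add', Category.comp_id]

theorem sum_assoc (S : AdditiveBundle q) (f g k : A ⟶ E) (h : f ≫ q = g ≫ q)
    (h' : g ≫ q = k ≫ q) :
    S.sum (S.sum f g h) k ((S.sum_comp _ _ _).trans (h.trans h')) =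
      S.sum f (S.sum g k h') (h.trans (S.sum_comp _ _ _).symm) := by
  obtain ⟨x, h₀, h₁, h₂⟩ := (S.pow 3).exists_triple f g k h h'
  have := congrArg (fun y => x ≫ y) S.add_assoc'
  simp only [AdditiveBundleData.comp_sum] at this
  simp only [h₀, h₁, h₂] at this
  exact this

end AdditiveBundle

/-- `(g, f)` is a morphism of additive bundles from `S` to `R`. -/
structure IsAdditiveMorphism {E M F N : X} {q : E ⟶ M} {r : F ⟶ N} (S : AdditiveBundle q)
    (R : AdditiveBundle r) (g : E ⟶ F) (f : M ⟶ N) : Prop where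
  comm : q ≫ f = g ≫ r
  zero_comp : S.zero ≫ g = f ≫ R.zero
  add_comp : S.add ≫ g = R.sum ((S.pow 2).proj 0 ≫ g) ((S.pow 2).proj 1 ≫ g) (by
    rw [Category.assoc, Category.assoc, ← comm, ← Category.assoc, ← Category.assoc,
      (S.pow 2).proj_comp_eq 0 1])

namespace IsAdditiveMorphism

variable {E M F N G K A : X} {q : E ⟶ M} {r : F ⟶ N} {s : G ⟶ K} {S : AdditiveBundle q}
  {R : AdditiveBundle r} {Q : AdditiveBundle s} {g : E ⟶ F} {f : M ⟶ N} {g' : F ⟶ G} {f' : N ⟶ K}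

theorem comp_eq (H : IsAdditiveMorphism S R g f) {x y : A ⟶ E} (h : x ≫ q = y ≫ q) :
    (x ≫ g) ≫ r = (y ≫ g) ≫ r := by
  rw [Category.assoc, Category.assoc, ← H.comm, ← Category.assoc, h, Category.assoc]

theorem sum_comp (H : IsAdditiveMorphism S R g f) (x y : A ⟶ E) (h : x ≫ q = y ≫ q) :
    S.sum x y h ≫ g = R.sum (x ≫ g) (y ≫ g) (H.comp_eq h) := by
  rw [AdditiveBundleData.sum, Category.assoc, H.add_comp, AdditiveBundleData.comp_sum]
  exact R.sum_congr _ (by simp [← Category.assoc]) (by simp [← Category.assoc])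

theorem comp (H : IsAdditiveMorphism S R g f) (H' : IsAdditiveMorphism R Q g' f') :
    IsAdditiveMorphism S Q (g ≫ g') (f ≫ f') where
  comm := by rw [← Category.assoc, H.comm, Category.assoc, H'.comm, Category.assoc]
  zero_comp := by rw [← Category.assoc, H.zero_comp, Category.assoc, H'.zero_comp, Category.assoc]
  add_comp := by
    rw [← Category.assoc, H.add_comp, H'.sum_comp]
    exact Q.sum_congr _ (by simp) (by simp)

end IsAdditiveMorphism

/-- The image of the operations under a functor that preserves the fibre powers. -/
def AdditiveBundleData.map {E M : X} {q : E ⟶ M} (S : AdditiveBundleData q) (F : X ⥤ X)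
    (hF : ∀ n, IsFibreProduct (fun _ : Fin n => F.map q) (F.map (S.pow n).base)
      (fun i => F.map ((S.pow n).proj i))) : AdditiveBundleData (F.map q) where
  pow n := ⟨F.obj (S.pow n).obj, F.map (S.pow n).base, fun i => F.map ((S.pow n).proj i), hF n⟩
  add := F.map S.add
  zero := F.map S.zero
  add_comp := by rw [← F.map_comp, S.add_comp]
  zero_comp := by rw [← F.map_comp, S.zero_comp, F.map_id]

theorem AdditiveBundleData.map_pair {E M A : X} {q : E ⟶ M} (S : AdditiveBundleData q) (F : X ⥤ X)
    (hF : ∀ n, IsFibreProduct (fun _ : Fin n => F.map q) (F.map (S.pow n).base)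
      (fun i => F.map ((S.pow n).proj i))) (f g : A ⟶ E) (h : f ≫ q = g ≫ q) :
    F.map ((S.pow 2).pair f g h) =
      ((S.map F hF).pow 2).pair (F.map f) (F.map g) (by rw [← F.map_comp, h, F.map_comp]) := by
  refine ((S.map F hF).pow 2).pair_ext ?_ ?_
  · rw [FibrePower.pair_fst]
    exact (F.map_comp _ _).symm.trans (congrArg F.map (FibrePower.pair_fst _ _ _ _))
  · rw [FibrePower.pair_snd]
    exact (F.map_comp _ _).symm.trans (congrArg F.map (FibrePower.pair_snd _ _ _ _))

theorem AdditiveBundleData.map_sum {E M A : X} {q : E ⟶ M} (S : AdditiveBundleData q) (F : X ⥤ X)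
    (hF : ∀ n, IsFibreProduct (fun _ : Fin n => F.map q) (F.map (S.pow n).base)
      (fun i => F.map ((S.pow n).proj i))) (f g : A ⟶ E) (h : f ≫ q = g ≫ q) :
    F.map (S.sum f g h) =
      (S.map F hF).sum (F.map f) (F.map g) (by rw [← F.map_comp, h, F.map_comp]) := by
  rw [AdditiveBundleData.sum, F.map_comp, S.map_pair F hF]
  rfl

/-- The image of an additive bundle under a functor that preserves its finite fibre powers. -/
def AdditiveBundle.map {E M : X} {q : E ⟶ M} (S : AdditiveBundle q) (F : X ⥤ X)
    (hF : ∀ n, IsFibreProduct (fun _ : Fin n => F.map q) (F.map (S.pow n).base)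
      (fun i => F.map ((S.pow n).proj i))) : AdditiveBundle (F.map q) where
  toAdditiveBundleData := S.toAdditiveBundleData.map F hF
  add_comm' := (S.map_sum F hF _ _ _).symm.trans (congrArg F.map S.add_comm')
  zero_add' := by
    have h := (S.map_sum F hF _ _ _).symm.trans (congrArg F.map S.zero_add')
    exact (AdditiveBundleData.sum_congr _ _ (F.map_comp _ _).symm (F.map_id _).symm).trans
      (h.trans (F.map_id _))
  add_assoc' := by
    have h := (S.map_sum F hF _ _ _).symm.trans
      ((congrArg F.map S.add_assoc').trans (S.map_sum F hF _ _ _))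
    exact (AdditiveBundleData.sum_congr _ _ (S.map_sum F hF _ _ _).symm rfl).trans
      (h.trans (AdditiveBundleData.sum_congr _ _ rfl (S.map_sum F hF _ _ _)))

theorem IsAdditiveMorphism.map {E M F N : X} {q : E ⟶ M} {r : F ⟶ N} {S : AdditiveBundle q}
    {R : AdditiveBundle r} {g : E ⟶ F} {f : M ⟶ N} (H : IsAdditiveMorphism S R g f) (U : X ⥤ X)
    (hS : ∀ n, IsFibreProduct (fun _ : Fin n => U.map q) (U.map (S.pow n).base)
      (fun i => U.map ((S.pow n).proj i)))
    (hR : ∀ n, IsFibreProduct (fun _ : Fin n => U.map r) (U.map (R.pow n).base)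
      (fun i => U.map ((R.pow n).proj i))) :
    IsAdditiveMorphism (S.map U hS) (R.map U hR) (U.map g) (U.map f) where
  comm := by rw [← U.map_comp, H.comm, U.map_comp]
  zero_comp := (U.map_comp _ _).symm.trans ((congrArg U.map H.zero_comp).trans (U.map_comp _ _))
  add_comp := by
    refine (U.map_comp _ _).symm.trans ((congrArg U.map H.add_comp).trans ?_)
    exact (R.map_sum U hR _ _ _).trans
      (AdditiveBundleData.sum_congr _ _ (U.map_comp _ _) (U.map_comp _ _))

end AdditiveBundles

section TangentCategories

variable {X : Type u} [Category.{v} X]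

/-- The `n`-fold composite `T ⋙ ⋯ ⋙ T`. -/
def iter (T : X ⥤ X) : ℕ → (X ⥤ X)
  | 0 => 𝟭 X
  | n + 1 => T ⋙ iter T n

/-- A fibre product that is preserved by all the iterates of `T`. -/
def IsTangentialFibreProduct (T : X ⥤ X) {I : Type w} {M P : X} {B : I → X} (f : ∀ i, B i ⟶ M)
    (b : P ⟶ M) (π : ∀ i, P ⟶ B i) : Prop :=
  ∀ n, IsFibreProduct (fun i => (iter T n).map (f i)) ((iter T n).map b)
    (fun i => (iter T n).map (π i))

/-- A pullback square that is preserved by all the iterates of `T`. -/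
def IsTangentialPullback (T : X ⥤ X) {P A B C : X} (fst : P ⟶ A) (snd : P ⟶ B) (f : A ⟶ C)
    (g : B ⟶ C) : Prop :=
  ∀ n, IsPullback ((iter T n).map fst) ((iter T n).map snd) ((iter T n).map f) ((iter T n).map g)

/-- The finite fibre powers of an additive bundle are tangential. -/
def AdditiveBundle.IsTangential (T : X ⥤ X) {E M : X} {q : E ⟶ M} (S : AdditiveBundle q) : Prop :=
  ∀ n, IsTangentialFibreProduct T (fun _ : Fin n => q) (S.pow n).base (S.pow n).proj

theorem AdditiveBundle.IsTangential.preserves {T : X ⥤ X} {E M : X} {q : E ⟶ M}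
    {S : AdditiveBundle q} (h : S.IsTangential T) (n : ℕ) :
    IsFibreProduct (fun _ : Fin n => T.map q) (T.map (S.pow n).base)
      (fun i => T.map ((S.pow n).proj i)) :=
  h n 1

/-- For an additive bundle with tangential fibre powers, its image under `T`. -/
abbrev AdditiveBundle.image (T : X ⥤ X) {E M : X} {q : E ⟶ M} (S : AdditiveBundle q)
    (h : S.IsTangential T) : AdditiveBundle (T.map q) :=
  S.map T h.preserves

theorem AdditiveBundle.IsTangential.image {T : X ⥤ X} {E M : X} {q : E ⟶ M}
    {S : AdditiveBundle q} (h : S.IsTangential T) : (S.image T h).IsTangential T :=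
  fun n m => h n (m + 1)

variable (X) in
/-- An additive bundle structure on a category: an endofunctor `T`, with an additive bundle
`(T M, p M, + , 0)` over each object `M` whose finite fibre powers are preserved by the iterates
of `T`, such that `p`, `+` and `0` are natural. -/
class AdditiveBundleStructure where
  T : X ⥤ X
  p : ∀ M : X, T.obj M ⟶ M
  bundle : ∀ M : X, AdditiveBundle (p M)
  tangential : ∀ M : X, (bundle M).IsTangential T
  natural : ∀ {M N : X} (f : M ⟶ N), IsAdditiveMorphism (bundle M) (bundle N) (T.map f) f

open AdditiveBundleStructure

section

variable [AdditiveBundleStructure X]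

/-- The zero section `0_M`. -/
def zer (M : X) : M ⟶ T.obj M := (bundle M).zero

theorem p_natural {M N : X} (f : M ⟶ N) : T.map f ≫ p N = p M ≫ f := (natural f).comm.symm

theorem zer_natural {M N : X} (f : M ⟶ N) : f ≫ zer N = zer M ≫ T.map f :=
  (natural f).zero_comp.symm

theorem zer_p (M : X) : zer M ≫ p M = 𝟙 M := (bundle M).zero_comp

/-- The morphism `μ` from `E ×_M E` to `T E`, namely `⟨π₁ λ, π₂ 0_E⟩` followed by `T(σ)`. -/
noncomputable def mu {E M : X} {q : E ⟶ M} (S : AdditiveBundle q) (hS : S.IsTangential T)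
    (lam : E ⟶ T.obj E) (h : lam ≫ T.map q = q ≫ zer M) : (S.pow 2).obj ⟶ T.obj E :=
  (S.image T hS).sum ((S.pow 2).proj 0 ≫ lam) ((S.pow 2).proj 1 ≫ zer E) (by
    rw [Category.assoc, h, Category.assoc, ← zer_natural, ← Category.assoc, ← Category.assoc,
      (S.pow 2).proj_comp_eq 0 1])

end

variable (X) in
/-- Tangent categories: the vertical lift is `ℓ` and the canonical flip is `c`. -/
class TangentCategory extends AdditiveBundleStructure X where
  ℓ : ∀ M : X, T.obj M ⟶ T.obj (T.obj M)
  ℓ_natural : ∀ {M N : X} (f : M ⟶ N), T.map f ≫ ℓ N = ℓ M ≫ T.map (T.map f)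
  c : ∀ M : X, T.obj (T.obj M) ⟶ T.obj (T.obj M)
  c_natural : ∀ {M N : X} (f : M ⟶ N), T.map (T.map f) ≫ c N = c M ≫ T.map (T.map f)
  ℓ_additive : ∀ M : X,
    IsAdditiveMorphism (bundle M) ((bundle M).image T (tangential M)) (ℓ M) (zer M)
  c_additive : ∀ M : X,
    IsAdditiveMorphism ((bundle M).image T (tangential M)) (bundle (T.obj M)) (c M) (𝟙 (T.obj M))
  c_c : ∀ M : X, c M ≫ c M = 𝟙 (T.obj (T.obj M))
  ℓ_c : ∀ M : X, ℓ M ≫ c M = ℓ M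
  ℓ_ℓ : ∀ M : X, ℓ M ≫ T.map (ℓ M) = ℓ M ≫ ℓ (T.obj M)
  c_braid : ∀ M : X,
    T.map (c M) ≫ c (T.obj M) ≫ T.map (c M) = c (T.obj M) ≫ T.map (c M) ≫ c (T.obj M)
  ℓ_c_c : ∀ M : X, ℓ (T.obj M) ≫ T.map (c M) ≫ c (T.obj M) = c M ≫ T.map (ℓ M)
  universality : ∀ M : X,
    IsTangentialPullback T (mu (bundle M) (tangential M) (ℓ M) (ℓ_additive M).comm.symm)
      ((bundle M).pow 2).base (T.map (p M)) (zer M)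

open TangentCategory

variable [TangentCategory X]

theorem zer_c (M : X) : T.map (zer M) ≫ c M = zer (T.obj M) :=
  (c_additive M).zero_comp.trans (Category.id_comp _)

/-- Differential bundles over `M`, with underlying object `(E, q)` of the slice over `M`. -/
structure DifferentialBundle {E M : X} (q : E ⟶ M) extends AdditiveBundle q where
  lift : E ⟶ T.obj E
  tangential : toAdditiveBundle.IsTangential T
  lift_additive_zer :
    IsAdditiveMorphism toAdditiveBundle (toAdditiveBundle.image T tangential) lift (zer M)
  lift_additive_zero : IsAdditiveMorphism toAdditiveBundle (bundle E) lift zero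
  universal :
    IsTangentialPullback T (mu toAdditiveBundle tangential lift lift_additive_zer.comm.symm)
      (pow 2).base (T.map q) (zer M)
  lift_lift : lift ≫ ℓ E = lift ≫ T.map lift

/-- The tangent bundle of `M` as a differential bundle. -/
def tangentBundle (M : X) : DifferentialBundle (p M) where
  toAdditiveBundle := bundle M
  lift := ℓ M
  tangential := AdditiveBundleStructure.tangential M
  lift_additive_zer := ℓ_additive M
  lift_additive_zero := by
    have h := (ℓ_additive M).comp (c_additive M)
    rw [ℓ_c, Category.comp_id] at h
    exact h
  universal := universality M
  lift_lift := (ℓ_ℓ M).symm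

namespace DifferentialBundle

variable {E M : X} {q : E ⟶ M}

/-- The morphism `μ` of a differential bundle. -/
noncomputable def μ (D : DifferentialBundle q) : (D.pow 2).obj ⟶ T.obj E :=
  mu D.toAdditiveBundle D.tangential D.lift D.lift_additive_zer.comm.symm

theorem lift_p (D : DifferentialBundle q) : D.lift ≫ p E = q ≫ D.zero :=
  D.lift_additive_zero.comm.symm

theorem μ_p (D : DifferentialBundle q) : D.μ ≫ p E = (D.pow 2).proj 1 := by
  have h : IsAdditiveMorphism (D.toAdditiveBundle.image T D.tangential) D.toAdditiveBundle
      (p E) (p M) := by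
    refine ⟨p_natural q, p_natural D.zero, (p_natural D.add).trans ?_⟩
    refine congrArg (fun y => y ≫ D.add) ((D.pow 2).pair_ext ?_ ?_)
    · exact (p_natural _).symm.trans (FibrePower.pair_fst _ _ _ _).symm
    · exact (p_natural _).symm.trans (FibrePower.pair_snd _ _ _ _).symm
  rw [μ, mu, h.sum_comp]
  refine Eq.trans (D.sum_congr _ ?_ ?_) (D.zero_sum ((D.pow 2).proj 1))
  · rw [Category.assoc, lift_p, ← Category.assoc, (D.pow 2).proj_comp_eq 0 1, Category.assoc]
  · rw [Category.assoc, zer_p, Category.comp_id]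

theorem c_image_image (D : DifferentialBundle q) :
    IsAdditiveMorphism ((D.toAdditiveBundle.image T D.tangential).image T D.tangential.image)
      ((D.toAdditiveBundle.image T D.tangential).image T D.tangential.image) (c E) (c M) := by
  refine ⟨c_natural q, c_natural D.zero, (c_natural D.add).trans ?_⟩
  refine congrArg (fun y => y ≫ T.map (T.map D.add)) 
    ((((D.toAdditiveBundle.image T D.tangential).image T D.tangential.image).pow 2).pair_ext ?_ ?_)
  · exact (c_natural _).symm.trans (FibrePower.pair_fst _ _ _ _).symm
  · exact (c_natural _).symm.trans (FibrePower.pair_snd _ _ _ _).symm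

theorem image_lift_additive (D : DifferentialBundle q) :
    IsAdditiveMorphism (D.toAdditiveBundle.image T D.tangential)
      ((D.toAdditiveBundle.image T D.tangential).image T D.tangential.image)
      (T.map D.lift ≫ c E) (zer (T.obj M)) := by
  have h := (D.lift_additive_zer.map T D.tangential.preserves
    D.tangential.image.preserves).comp D.c_image_image
  rw [zer_c] at h
  exact h

theorem map_μ_c (D : DifferentialBundle q) :
    mu (D.toAdditiveBundle.image T D.tangential) D.tangential.image (T.map D.lift ≫ c E)
      D.image_lift_additive.comm.symm = T.map D.μ ≫ c E := by
  have h : T.map D.μ = _ := AdditiveBundleData.map_sum _ T D.tangential.image.preserves _ _ _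
  rw [h]
  refine Eq.trans ?_ (D.c_image_image.sum_comp _ _ _).symm
  refine AdditiveBundleData.sum_congr _ _ ?_ ?_
  · exact ((congrArg (fun y => y ≫ c E) (T.map_comp _ _)).trans (Category.assoc _ _ _)).symm
  · refine (((congrArg (fun y => y ≫ c E) (T.map_comp _ _)).trans
      (Category.assoc _ _ _)).trans ?_).symm
    exact congrArg (fun y => T.map ((D.pow 2).proj 1) ≫ y) (zer_c E)

/-- The differential bundle `(T E, T(q), T(σ), T(ζ), T(λ) c_E)` over `T M`. -/
def image (D : DifferentialBundle q) : DifferentialBundle (T.map q) where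
  toAdditiveBundle := D.toAdditiveBundle.image T D.tangential
  lift := T.map D.lift ≫ c E
  tangential := D.tangential.image
  lift_additive_zer := D.image_lift_additive
  lift_additive_zero := by
    have h := (D.lift_additive_zero.map T D.tangential.preserves
      (AdditiveBundleStructure.tangential E).preserves).comp (c_additive E)
    rw [Category.comp_id] at h
    exact h
  universal := by
    intro n
    have hc : IsIso (c E) := ⟨c E, c_c E, c_c E⟩
    have hc' : IsIso (c M) := ⟨c M, c_c M, c_c M⟩
    have h₁ : IsPullback ((iter T n).map (T.map D.μ)) ((iter T n).map (T.map (D.pow 2).base))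
      ((iter T n).map (T.map (T.map q))) ((iter T n).map (T.map (zer M))) := D.universal (n + 1)
    have h₂ : IsPullback ((iter T n).map (c E)) ((iter T n).map (T.map (T.map q)))
        ((iter T n).map (T.map (T.map q))) ((iter T n).map (c M)) :=
      IsPullback.of_horiz_isIso ⟨by rw [← Functor.map_comp, ← Functor.map_comp, c_natural]⟩
    have h₃ := h₁.paste_horiz h₂
    rw [← Functor.map_comp, ← Functor.map_comp, zer_c, ← map_μ_c] at h₃
    exact h₃
  lift_lift := by
    have h : T.map (ℓ E) ≫ c (T.obj E) ≫ T.map (c E) = c E ≫ ℓ (T.obj E) := by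
      have h₁ : T.map (ℓ E) = c E ≫ ℓ (T.obj E) ≫ T.map (c E) ≫ c (T.obj E) := by
        rw [ℓ_c_c, ← Category.assoc, c_c, Category.id_comp]
      rw [h₁]
      simp only [Category.assoc]
      rw [← Category.assoc (c (T.obj E)) (c (T.obj E)), c_c, Category.id_comp, ← T.map_comp, c_c,
        T.map_id, Category.comp_id]
    rw [Category.assoc, ← h, ← Category.assoc, ← T.map_comp, D.lift_lift, T.map_comp, T.map_comp]
    simp only [Category.assoc]
    rw [← Category.assoc (T.map (T.map D.lift)), c_natural, Category.assoc]

end DifferentialBundle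

/-- `(g, f)` is a linear morphism of differential bundles from `D` to `R`. -/
structure IsLinear {E M F N : X} {q : E ⟶ M} {r : F ⟶ N} (D : DifferentialBundle q)
    (R : DifferentialBundle r) (g : E ⟶ F) (f : M ⟶ N) : Prop where
  comm : q ≫ f = g ≫ r
  lift_comp : D.lift ≫ T.map g = g ≫ R.lift

theorem IsLinear.comp {E M F N G K : X} {q : E ⟶ M} {r : F ⟶ N} {s : G ⟶ K}
    {D : DifferentialBundle q} {R : DifferentialBundle r} {Q : DifferentialBundle s} {g : E ⟶ F}
    {f : M ⟶ N} {g' : F ⟶ G} {f' : N ⟶ K} (h : IsLinear D R g f) (h' : IsLinear R Q g' f') :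
    IsLinear D Q (g ≫ g') (f ≫ f') where
  comm := by rw [← Category.assoc, h.comm, Category.assoc, h'.comm, Category.assoc]
  lift_comp := by
    rw [T.map_comp, ← Category.assoc, h.lift_comp, Category.assoc, h'.lift_comp, Category.assoc]

theorem IsLinear.id {E M : X} {q : E ⟶ M} (D : DifferentialBundle q) :
    IsLinear D D (𝟙 E) (𝟙 M) :=
  ⟨by simp, by simp⟩

section AllBases

variable (X) in
/-- Differential bundles over arbitrary bases. -/
structure DBun where
  obj : X
  base : X
  proj : obj ⟶ base
  bundle : DifferentialBundle proj

/-- A differential bundle as an object of `DBun`. -/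
abbrev DBun.of {E M : X} {q : E ⟶ M} (D : DifferentialBundle q) : DBun X := ⟨E, M, q, D⟩

/-- Linear morphisms between differential bundles over arbitrary bases. -/
@[ext]
structure DBun.Hom (A B : DBun X) where
  top : A.obj ⟶ B.obj
  bot : A.base ⟶ B.base
  linear : IsLinear A.bundle B.bundle top bot

instance : Category (DBun X) where
  Hom := DBun.Hom
  id _ := ⟨𝟙 _, 𝟙 _, IsLinear.id _⟩
  comp f g := ⟨f.top ≫ g.top, f.bot ≫ g.bot, f.linear.comp g.linear⟩
  id_comp _ := DBun.Hom.ext (Category.id_comp _) (Category.id_comp _)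
  comp_id _ := DBun.Hom.ext (Category.comp_id _) (Category.comp_id _)
  assoc _ _ _ := DBun.Hom.ext (Category.assoc _ _ _) (Category.assoc _ _ _)

variable (X) in
/-- The functor that sends a differential bundle to its base. -/
def cod : DBun X ⥤ X where
  obj A := A.base
  map f := DBun.Hom.bot f

/-- `P` is a pullback of `D` along `f`, by way of a cartesian arrow `(f', f)` from `P` to `D`. -/
def IsPullbackBundle {E M W N : X} {a : W ⟶ N} {q : E ⟶ M} (P : DifferentialBundle a)
    (D : DifferentialBundle q) (f' : W ⟶ E) (f : N ⟶ M) : Prop :=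
  ∃ h : IsLinear P D f' f,
    (cod X).IsStronglyCartesian f (⟨f', f, h⟩ : DBun.Hom (DBun.of P) (DBun.of D))

end AllBases

section FixedBase

/-- Differential bundles over `M`. -/
structure DBunOver (M : X) where
  obj : X
  proj : obj ⟶ M
  bundle : DifferentialBundle proj

variable {M : X}

/-- A differential bundle over `M` as an object of `DBunOver M`. -/
abbrev DBunOver.of {E : X} {q : E ⟶ M} (D : DifferentialBundle q) : DBunOver M := ⟨E, q, D⟩

/-- Linear morphisms between differential bundles over `M`. -/
@[ext]
structure DBunOver.Hom (A B : DBunOver M) where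
  hom : A.obj ⟶ B.obj
  linear : IsLinear A.bundle B.bundle hom (𝟙 M)

instance : Category (DBunOver M) where
  Hom := DBunOver.Hom
  id _ := ⟨𝟙 _, IsLinear.id _⟩
  comp f g := ⟨f.hom ≫ g.hom, by simpa using f.linear.comp g.linear⟩
  id_comp _ := DBunOver.Hom.ext (Category.id_comp _)
  comp_id _ := DBunOver.Hom.ext (Category.comp_id _)
  assoc _ _ _ := DBunOver.Hom.ext (Category.assoc _ _ _)

theorem DBunOver.Hom.w {A B : DBunOver M} (f : DBunOver.Hom A B) : f.hom ≫ B.proj = A.proj := by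
  rw [← f.linear.comm, Category.comp_id]

theorem DBunOver.Hom.w_eq {A B : DBunOver M} (f g : DBunOver.Hom A B) :
    f.hom ≫ B.proj = g.hom ≫ B.proj := by
  rw [f.w, g.w]

/-- The pointwise addition of linear morphisms over `M`. -/
noncomputable instance DBunOver.homAdd (A B : DBunOver M) : Add (A ⟶ B) where
  add f g := ⟨B.bundle.sum (DBunOver.Hom.hom f) (DBunOver.Hom.hom g) (DBunOver.Hom.w_eq f g), by
    have hf : A.bundle.lift ≫ T.map (DBunOver.Hom.hom f) = DBunOver.Hom.hom f ≫ B.bundle.lift :=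
      (DBunOver.Hom.linear f).lift_comp
    have hg : A.bundle.lift ≫ T.map (DBunOver.Hom.hom g) = DBunOver.Hom.hom g ≫ B.bundle.lift :=
      (DBunOver.Hom.linear g).lift_comp
    refine ⟨?_, ?_⟩
    · rw [B.bundle.sum_comp, DBunOver.Hom.w, Category.comp_id]
    · rw [B.bundle.lift_additive_zer.sum_comp,
        AdditiveBundleData.map_sum _ T B.bundle.tangential.preserves,
        AdditiveBundleData.comp_sum]
      exact AdditiveBundleData.sum_congr _ _ hf hg⟩

/-- The zero morphism is the composite of the projection of `A` and the zero section of `B`. -/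
instance DBunOver.homZero (A B : DBunOver M) : Zero (A ⟶ B) where
  zero := ⟨A.proj ≫ B.bundle.zero, by
    refine ⟨?_, ?_⟩
    · rw [Category.assoc, B.bundle.zero_comp]
    · have h : B.bundle.zero ≫ B.bundle.lift = zer M ≫ T.map B.bundle.zero :=
        B.bundle.lift_additive_zer.zero_comp
      rw [Category.assoc, h, T.map_comp, ← Category.assoc, A.bundle.lift_additive_zer.comm.symm,
        Category.assoc]⟩

noncomputable instance DBunOver.homAddCommMonoid (A B : DBunOver M) : AddCommMonoid (A ⟶ B) where
  add_assoc f g k := DBunOver.Hom.ext (B.bundle.sum_assoc _ _ _ _ _)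
  add_comm f g := DBunOver.Hom.ext (B.bundle.sum_comm _ _ _)
  zero_add f := DBunOver.Hom.ext (by
    refine Eq.trans (B.bundle.sum_congr _ ?_ rfl) (B.bundle.zero_sum (DBunOver.Hom.hom f))
    exact (congrArg (fun y => y ≫ B.bundle.zero) (DBunOver.Hom.w f).symm).trans
      (Category.assoc _ _ _))
  add_zero f := DBunOver.Hom.ext (by
    refine Eq.trans (B.bundle.sum_comm _ _ _) ?_
    refine Eq.trans (B.bundle.sum_congr _ ?_ rfl) (B.bundle.zero_sum (DBunOver.Hom.hom f))
    exact (congrArg (fun y => y ≫ B.bundle.zero) (DBunOver.Hom.w f).symm).trans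
      (Category.assoc _ _ _))
  nsmul := nsmulRec

/-- A biproduct of a finite family of differential bundles over `M`, in terms of the pointwise
addition of linear morphisms. -/
structure IsBiproduct {I : Type w} [Fintype I] {Q : I → DBunOver M} {F : DBunOver M}
    (π : ∀ i, F ⟶ Q i) (ι : ∀ i, Q i ⟶ F) : Prop where
  inj_proj_self : ∀ i, ι i ≫ π i = 𝟙 (Q i)
  inj_proj_ne : ∀ i j, i ≠ j → ι i ≫ π j = 0
  sum_eq : ∑ i, π i ≫ ι i = 𝟙 F

/-- A product of differential bundles over `M`. -/
def IsProduct {I : Type w} {Q : I → DBunOver M} {F : DBunOver M} (π : ∀ i, F ⟶ Q i) : Prop :=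
  Nonempty (IsLimit (Fan.mk F π))

/-- `P` is a `j`-th partial bundle of the product `F` of the `Q i` with projections `π i` : the
projection underlying `P` is that of `π j`, and there is a cartesian arrow from `P` to the product
`G` of the `Q i` with `i ≠ j`, given by the canonical projection from `F` to `G` and by the
projection from `Q j` to `M`. -/
def IsPartialBundle {I : Type w} {Q : I → DBunOver M} {F : DBunOver M} (π : ∀ i, F ⟶ Q i) (j : I)
    {s : F.obj ⟶ (Q j).obj} (P : DifferentialBundle s) : Prop :=
  s = DBunOver.Hom.hom (π j) ∧
    ∃ (G : DBunOver M) (ρ : ∀ i : {i : I // i ≠ j}, G ⟶ Q i) (hG : IsLimit (Fan.mk G ρ)),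
      IsPullbackBundle P G.bundle
        (DBunOver.Hom.hom (Fan.IsLimit.lift hG fun i : {i : I // i ≠ j} => π i)) (Q j).proj

end FixedBase

section Connections

/-- Vertical connections on a differential bundle. -/
structure IsVerticalConnection {E M : X} {q : E ⟶ M} (D : DifferentialBundle q)
    (K : T.obj E ⟶ E) : Prop where
  retraction : D.lift ≫ K = 𝟙 E
  linear_image : IsLinear D.image D K (p M)
  linear_tangent : IsLinear (tangentBundle E) D K q

variable {E M W : X} {q : E ⟶ M} {a : W ⟶ E} {b : W ⟶ T.obj M}

/-- The morphism `U = ⟨p_E, T(q)⟩` into a fibre product `W = E ×_M T M`. -/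
noncomputable def projPair (hW : IsPullback a b q (p M)) : T.obj E ⟶ W :=
  hW.lift (p E) (T.map q) (p_natural q).symm

/-- Horizontal connections on a differential bundle, with respect to a fibre product
`W = E ×_M T M` with projections `a` and `b`. The object `W` carries the pullback of the tangent
bundle of `M` along `q` and the pullback of the given differential bundle along `p M`. -/
structure IsHorizontalConnection (D : DifferentialBundle q) (hW : IsPullback a b q (p M))
    (H : W ⟶ T.obj E) : Prop where
  isSection : H ≫ projPair hW = 𝟙 W
  linear_tangent : ∃ P : DifferentialBundle a, IsPullbackBundle P (tangentBundle M) b q ∧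
    IsLinear P (tangentBundle E) H (𝟙 E)
  linear_image : ∃ P : DifferentialBundle b, IsPullbackBundle P D a (p M) ∧
    IsLinear P D.image H (𝟙 (T.obj M))

theorem IsVerticalConnection.comp_proj {D : DifferentialBundle q} {K : T.obj E ⟶ E}
    (hK : IsVerticalConnection D K) : K ≫ q = p E ≫ q :=
  hK.linear_tangent.comm.symm

theorem IsHorizontalConnection.comp_p {D : DifferentialBundle q} {hW : IsPullback a b q (p M)}
    {H : W ⟶ T.obj E} (hH : IsHorizontalConnection D hW H) : H ≫ p E = a := by
  have h := congrArg (fun y => y ≫ a) hH.isSection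
  simpa [projPair] using h

/-- Connections on a differential bundle, consisting of a vertical connection `K` and a horizontal
connection `H`, with `H K = π₁ q ζ` and with `⟨K, p_E⟩ μ + U H = 1`, where the sum is taken in
the tangent bundle of `E`. -/
structure Connection (D : DifferentialBundle q) (hW : IsPullback a b q (p M)) where
  K : T.obj E ⟶ E
  H : W ⟶ T.obj E
  vertical : IsVerticalConnection D K
  horizontal : IsHorizontalConnection D hW H
  comp_eq : H ≫ K = a ≫ q ≫ D.zero
  sum_eq : (tangentBundle E).sum ((D.pow 2).pair K (p E) vertical.comp_proj ≫ D.μ)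
    (projPair hW ≫ H) (by
      rw [Category.assoc, D.μ_p, FibrePower.pair_snd, Category.assoc, horizontal.comp_p]
      exact (hW.lift_fst _ _ _).symm) = 𝟙 (T.obj E)

/-- Affine connections on `M` : connections on the tangent bundle of `M`, where `TM ×_M TM` is the
specified second fibre power of `p M`. -/
abbrev AffineConnection (M : X) :=
  Connection (tangentBundle M) ((tangentBundle M).pow 2).isPullback

/-- Vertical connections on the tangent bundle of `M` such that `p_{TM}`, `T(p_M)` and `K` present
`T²M` as a fibre product of three instances of `p_M`. -/
def IsEffectiveVerticalConnection (M : X) (K : T.obj (T.obj M) ⟶ T.obj M) : Prop :=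
  IsVerticalConnection (tangentBundle M) K ∧
    IsFibreProduct (fun _ : Fin 3 => p M) (p (T.obj M) ≫ p M) ![p (T.obj M), T.map (p M), K]

end Connections

end TangentCategories

end TangentCat

open TangentCat AdditiveBundleStructure TangentCategory

-- An affine connection splits T²M over M into three copies of TM, through p_{TM}, T(p_M) and K. The
-- inverse sends (u, v, w) to ⟨w, u⟩μ + ⟨u, v⟩H. The three components of this sum follow from the
-- linearity of K for both bundle structures on T²M and from the vanishing of HK
-- (`IsVerticalConnection.sum_components`), while the equation ⟨K, p⟩μ + UH = 1 says that an element
-- of T²M is recovered from its components. So K is effective. Conversely, an effective K forces H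
-- to be the morphism with components π₁, π₂ and zero. This H is a horizontal connection: its
-- linearity is a pair of equations in T³M, which may be tested on the images under T of the three
-- projections. Hence K determines H, and affine connections correspond to effective vertical
-- connections.
--
-- The other two sets consist of the same morphisms. If K is effective, then T²M is isomorphic to
-- the third fibre power T₃M, so the fibre product is automatically tangential. It therefore carries
-- the componentwise differential bundle structure, which is a product of bundles, and a biproduct
-- because linear morphisms are additive (`IsLinear.additive`) and composition is thus bilinear. A
-- bundle living on one projection is a partial bundle as soon as the other projections are linear
-- on it. In the other direction, a product of bundles is a biproduct, and its injections and sums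
-- build the mediating morphisms from arbitrary objects, so the underlying object is a fibre product
-- in the ambient category (`IsProduct.isWidePullback`); the two partial bundles express exactly the
-- two linearity conditions on K.
--
-- No limits are assumed in the ambient category. All limits in use are fibre powers of differential
-- bundles, or fibre powers regarded over one of their factors, and wide pullbacks of a morphism
-- with copies of a bundle projection treat both cases at once.

universe w'

namespace TangentCat

/-! ### Wide pullbacks and their preservation by the iterates of `T` -/

section WidePullbacks

variable {X : Type u} [Category.{v} X]

/-- `W` is the limit of `f : N ⟶ M` and of `J` instances of `q : E ⟶ M`, with projections
`s : W ⟶ N` and `φ j : W ⟶ E`. -/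
structure IsWidePullback {J : Type w} {E M N W : X} (f : N ⟶ M) (q : E ⟶ M) (s : W ⟶ N)
    (φ : J → (W ⟶ E)) : Prop where
  comm : ∀ j, φ j ≫ q = s ≫ f
  exists_lift : ∀ {A : X} (n : A ⟶ N) (e : J → (A ⟶ E)), (∀ j, e j ≫ q = n ≫ f) →
    ∃ x : A ⟶ W, x ≫ s = n ∧ ∀ j, x ≫ φ j = e j
  hom_ext : ∀ {A : X} {x y : A ⟶ W}, x ≫ s = y ≫ s → (∀ j, x ≫ φ j = y ≫ φ j) → x = y

/-- Taking `f = 𝟙 M` makes the leg to `M` part of the cone, as it is in the slice; this matters for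
the empty family. -/
theorem isFibreProduct_iff_isWidePullback {J : Type w} {E M W : X} {q : E ⟶ M} {s : W ⟶ M}
    {φ : J → (W ⟶ E)} :
    IsFibreProduct (fun _ : J => q) s φ ↔ IsWidePullback (𝟙 M) q s φ := by
  rw [isFibreProduct_iff]
  constructor
  · rintro ⟨h, hu⟩
    refine ⟨fun j => by simp [h], fun {A} n e he => ?_, fun {A x y} hs hφ => ?_⟩
    · exact (hu A n e fun j => by simp [he]).exists
    · refine (hu A (x ≫ s) (fun j => x ≫ φ j) fun j => ?_).unique ⟨rfl, fun _ => rfl⟩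
        ⟨hs.symm, fun j => (hφ j).symm⟩
      simp [h]
  · rintro ⟨h, hl, hu⟩
    refine ⟨fun j => by simpa using h j, fun A a g hg => ?_⟩
    obtain ⟨x, hx, hx'⟩ := hl a g fun j => by simpa using hg j
    exact ⟨x, ⟨hx, hx'⟩, fun y hy => hu (hy.1.trans hx.symm) fun j =>
      (hy.2 j).trans (hx' j).symm⟩

namespace IsWidePullback

variable {J : Type w} {J' : Type w'} {E M N W V A : X} {f : N ⟶ M} {q : E ⟶ M} {s : W ⟶ N}
  {φ : J → (W ⟶ E)} {t : V ⟶ N}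

/-- The morphism into a wide pullback with given components. -/
noncomputable def lift (h : IsWidePullback f q s φ) (n : A ⟶ N) (e : J → (A ⟶ E))
    (he : ∀ j, e j ≫ q = n ≫ f) : A ⟶ W :=
  (h.exists_lift n e he).choose

@[simp]
theorem lift_base (h : IsWidePullback f q s φ) (n : A ⟶ N) (e : J → (A ⟶ E))
    (he : ∀ j, e j ≫ q = n ≫ f) : h.lift n e he ≫ s = n :=
  (h.exists_lift n e he).choose_spec.1

@[simp]
theorem lift_proj (h : IsWidePullback f q s φ) (n : A ⟶ N) (e : J → (A ⟶ E))
    (he : ∀ j, e j ≫ q = n ≫ f) (j : J) : h.lift n e he ≫ φ j = e j :=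
  (h.exists_lift n e he).choose_spec.2 j

theorem reindex (h : IsWidePullback f q s φ) (e : J' ≃ J) :
    IsWidePullback f q s fun j => φ (e j) where
  comm j := h.comm (e j)
  exists_lift n g hg := by
    obtain ⟨x, hx, hx'⟩ := h.exists_lift n (fun j => g (e.symm j)) fun j => hg _
    exact ⟨x, hx, fun j => by simpa using hx' (e j)⟩
  hom_ext hs hφ := h.hom_ext hs fun j => by simpa using hφ (e.symm j)

/-- Two limits of the same diagram are isomorphic. -/
theorem exists_iso {ψ : J → (V ⟶ E)} (h : IsWidePullback f q s φ) (h' : IsWidePullback f q t ψ) :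
    ∃ i : W ≅ V, i.hom ≫ t = s ∧ ∀ j, i.hom ≫ ψ j = φ j := by
  refine ⟨⟨h'.lift s φ h.comm, h.lift t ψ h'.comm, h.hom_ext ?_ ?_, h'.hom_ext ?_ ?_⟩, ?_, ?_⟩ <;>
  simp

theorem of_iso {ψ : J → (V ⟶ E)} (h' : IsWidePullback f q t ψ) (i : W ≅ V) (hs : i.hom ≫ t = s)
    (hφ : ∀ j, i.hom ≫ ψ j = φ j) : IsWidePullback f q s φ where
  comm j := by rw [← hφ, ← hs, Category.assoc, Category.assoc, h'.comm]
  exists_lift n e he := ⟨h'.lift n e he ≫ i.inv, by simp [← hs], fun j => by simp [← hφ]⟩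
  hom_ext {A x y} h₀ h₁ := by
    rw [← cancel_mono i.hom]
    exact h'.hom_ext (by simpa [hs] using h₀) fun j => by simpa [hφ] using h₁ j

/-- Fibre products of wide pullbacks. -/
theorem isFibreProduct_of_prod {I : Type w'} (h : IsWidePullback f q s φ) {ψ : I × J → (V ⟶ E)}
    (h' : IsWidePullback f q t ψ) (π : I → (V ⟶ W)) (hs : ∀ i, π i ≫ s = t)
    (hφ : ∀ i j, π i ≫ φ j = ψ (i, j)) : IsFibreProduct (fun _ : I => s) t π := by
  rw [isFibreProduct_iff_isWidePullback]
  refine ⟨fun i => by simp [hs], fun n e he => ?_, fun {A x y} h₀ h₁ => h'.hom_ext h₀ ?_⟩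
  · have he' : ∀ i, e i ≫ s = n := fun i => by simpa using he i
    refine ⟨h'.lift n (fun a => e a.1 ≫ φ a.2) fun a => ?_, by simp, fun i => h.hom_ext ?_ ?_⟩
    · rw [Category.assoc, h.comm, ← Category.assoc, he']
    · simp [hs, he']
    · simp [hφ]
  · rintro ⟨i, j⟩
    rw [← hφ, ← Category.assoc, h₁, Category.assoc]

/-- A fibre product of instances of `q` is a pullback of one instance and of the fibre product of
the others. -/
theorem isPullback_of_ne [DecidableEq J] {E M P G : X} {q : E ⟶ M} {b : P ⟶ M} {π : J → (P ⟶ E)}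
    (h : IsWidePullback (𝟙 M) q b π) (j : J) {g : G ⟶ M} {ρ : {i : J // i ≠ j} → (G ⟶ E)}
    (h' : IsWidePullback (𝟙 M) q g ρ) {k : P ⟶ G} (hk : k ≫ g = b) (hk' : ∀ i, k ≫ ρ i = π i) :
    IsPullback k (π j) g q := by
  have hp : ∀ i, π i ≫ q = b := fun i => by simpa using h.comm i
  have hr : ∀ i, ρ i ≫ q = g := fun i => by simpa using h'.comm i
  have key : ∀ {A : X} (x : A ⟶ G) (y : A ⟶ E), x ≫ g = y ≫ q →
      ∃ z : A ⟶ P, z ≫ k = x ∧ z ≫ π j = y := by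
    intro A x y hxy
    -- The factor at `j` comes from `y`, and all the others are read off from `x` by the projections
    -- of `G`.
    refine ⟨h.lift (x ≫ g) (fun i => if hi : i = j then y else x ≫ ρ ⟨i, hi⟩) fun i => ?_, ?_, ?_⟩
    · by_cases hi : i = j
      · simp [hi, hxy]
      · simp [hi, hr]
    · refine h'.hom_ext (by simp [hk]) fun i => ?_
      simp [hk', i.2]
    · simp
  choose l hl hl' using @key
  refine ⟨⟨by rw [hk, hp]⟩, ⟨PullbackCone.IsLimit.mk _ (fun c => l c.fst c.snd c.condition)
    (fun c => hl _ _ _) (fun c => hl' _ _ _) fun c m h₀ h₁ => ?_⟩⟩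
  have h₀' : m ≫ k = l c.fst c.snd c.condition ≫ k := h₀.trans (hl _ _ _).symm
  refine h.hom_ext ?_ fun i => ?_
  · rw [← hk, ← Category.assoc, h₀', Category.assoc]
  · by_cases hi : i = j
    · subst hi
      exact h₁.trans (hl' _ _ _).symm
    · rw [← hk' ⟨i, hi⟩, ← Category.assoc, h₀', Category.assoc]

end IsWidePullback

theorem FibrePower.isWidePullback {E M : X} {q : E ⟶ M} {n : ℕ} (P : FibrePower q n) :
    IsWidePullback (𝟙 M) q P.base P.proj :=
  isFibreProduct_iff_isWidePullback.1 P.isFibreProduct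

/-- A fibre power is the fibre product of the remaining factors, pulled back to one factor. -/
theorem IsWidePullback.split {E M W : X} {q : E ⟶ M} {n : ℕ} {b : W ⟶ M}
    {π : Fin (n + 1) → (W ⟶ E)} (h : IsWidePullback (𝟙 M) q b π) (i : Fin (n + 1)) :
    IsWidePullback q q (π i) fun j : Fin n => π (i.succAbove j) := by
  have hp : ∀ i, π i ≫ q = b := fun i => by simpa using h.comm i
  refine ⟨fun j => by rw [hp, hp], fun {A} x e he => ?_, fun {A x y} h₀ h₁ => ?_⟩
  · obtain ⟨z, _, hz⟩ := h.exists_lift (x ≫ q) (i.insertNth x e) fun j => by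
      refine Fin.succAboveCases i ?_ (fun j => ?_) j <;> simp [he]
    exact ⟨z, by simpa using hz i, fun j => by simpa using hz (i.succAbove j)⟩
  · refine h.hom_ext ?_ fun j => ?_
    · rw [← hp i, ← Category.assoc, h₀, Category.assoc]
    · exact Fin.succAboveCases i h₀ h₁ j

/-- A wide pullback that is preserved by the iterates of `T`. -/
def IsTangentialWidePullback (T : X ⥤ X) {J : Type w} {E M N W : X} (f : N ⟶ M) (q : E ⟶ M)
    (s : W ⟶ N) (φ : J → (W ⟶ E)) : Prop :=
  ∀ k, IsWidePullback ((iter T k).map f) ((iter T k).map q) ((iter T k).map s)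
    fun j => (iter T k).map (φ j)

theorem isTangentialFibreProduct_iff {T : X ⥤ X} {J : Type w} {E M W : X} {q : E ⟶ M} {s : W ⟶ M}
    {φ : J → (W ⟶ E)} :
    IsTangentialFibreProduct T (fun _ : J => q) s φ ↔ IsTangentialWidePullback T (𝟙 M) q s φ := by
  refine forall_congr' fun k => ?_
  rw [isFibreProduct_iff_isWidePullback, CategoryTheory.Functor.map_id]

namespace IsTangentialWidePullback

variable {T : X ⥤ X} {J : Type w} {J' : Type w'} {E M N W V : X} {f : N ⟶ M} {q : E ⟶ M}
  {s : W ⟶ N} {φ : J → (W ⟶ E)} {t : V ⟶ N}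

theorem isWidePullback (h : IsTangentialWidePullback T f q s φ) : IsWidePullback f q s φ := h 0

theorem map (h : IsTangentialWidePullback T f q s φ) :
    IsWidePullback (T.map f) (T.map q) (T.map s) fun j => T.map (φ j) := h 1

theorem map_map (h : IsTangentialWidePullback T f q s φ) :
    IsWidePullback (T.map (T.map f)) (T.map (T.map q)) (T.map (T.map s))
      fun j => T.map (T.map (φ j)) := h 2

theorem reindex (h : IsTangentialWidePullback T f q s φ) (e : J' ≃ J) :
    IsTangentialWidePullback T f q s fun j => φ (e j) :=
  fun k => (h k).reindex e

/-- Preservation does not depend on the choice of the limit. -/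
theorem of_isWidePullback (h : IsWidePullback f q s φ) {ψ : J → (V ⟶ E)}
    (h' : IsTangentialWidePullback T f q t ψ) : IsTangentialWidePullback T f q s φ := by
  obtain ⟨i, hs, hφ⟩ := h.exists_iso h'.isWidePullback
  refine fun k => (h' k).of_iso ((iter T k).mapIso i) ?_ fun j => ?_
  · rw [Functor.mapIso_hom, ← Functor.map_comp, hs]
  · rw [Functor.mapIso_hom, ← Functor.map_comp, hφ]

theorem isTangentialFibreProduct_of_prod {I : Type w'} (h : IsTangentialWidePullback T f q s φ)
    {ψ : I × J → (V ⟶ E)} (h' : IsTangentialWidePullback T f q t ψ) (π : I → (V ⟶ W))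
    (hs : ∀ i, π i ≫ s = t) (hφ : ∀ i j, π i ≫ φ j = ψ (i, j)) :
    IsTangentialFibreProduct T (fun _ : I => s) t π :=
  fun k => (h k).isFibreProduct_of_prod (h' k) _ (fun i => by rw [← Functor.map_comp, hs])
    fun i j => by rw [← Functor.map_comp, hφ]

/-- This supplies the wide pullbacks along `q` itself, and hence the pullback of a bundle along its
own projection, with no assumption on the existence of limits. -/
theorem split {n : ℕ} {b : W ⟶ M} {π : Fin (n + 1) → (W ⟶ E)}
    (h : IsTangentialWidePullback T (𝟙 M) q b π) (i : Fin (n + 1)) :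
    IsTangentialWidePullback T q q (π i) fun j : Fin n => π (i.succAbove j) := by
  intro k
  have := h k
  rw [CategoryTheory.Functor.map_id] at this
  exact this.split i

theorem isTangentialPullback_of_ne [DecidableEq J] {P G : X} {b : P ⟶ M} {π : J → (P ⟶ E)}
    (h : IsTangentialWidePullback T (𝟙 M) q b π) (j : J) {g : G ⟶ M}
    {ρ : {i : J // i ≠ j} → (G ⟶ E)} (h' : IsTangentialWidePullback T (𝟙 M) q g ρ) {k : P ⟶ G}
    (hk : k ≫ g = b) (hk' : ∀ i, k ≫ ρ i = π i) :
    IsTangentialPullback T k (π j) g q := by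
  intro n
  have h₀ := h n
  have h₁ := h' n
  rw [CategoryTheory.Functor.map_id] at h₀ h₁
  exact h₀.isPullback_of_ne j h₁ (by rw [← Functor.map_comp, hk])
    fun i => by rw [← Functor.map_comp, hk']

theorem isTangentialPullback {φ : W ⟶ E}
    (h : IsTangentialWidePullback T f q s fun _ : Unit => φ) : IsTangentialPullback T φ s q f :=
  fun n => ⟨⟨(h n).comm ()⟩, ⟨PullbackCone.IsLimit.mk _
    (fun c => (h n).lift c.snd (fun _ => c.fst) fun _ => c.condition)
    (fun c => (h n).lift_proj _ _ _ ()) (fun c => (h n).lift_base _ _ _)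
    (fun c m h₀ h₁ => (h n).hom_ext (by simpa using h₁) fun _ => by
      exact h₀.trans ((h n).lift_proj c.snd (fun _ => c.fst) (fun _ => c.condition) ()).symm)⟩⟩

end IsTangentialWidePullback

end WidePullbacks

/-! ### Componentwise additive bundles on wide pullbacks -/

section AdditiveBundlesOnLimits

variable {X : Type u} [Category.{v} X] {J : Type w} {E M N W A : X} {f : N ⟶ M} {q : E ⟶ M}
  {s : W ⟶ N} {φ : J → (W ⟶ E)}

theorem IsWidePullback.comp_proj_eq (h : IsWidePullback f q s φ) {x y : A ⟶ W}
    (hxy : x ≫ s = y ≫ s) (j : J) : (x ≫ φ j) ≫ q = (y ≫ φ j) ≫ q := by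
  rw [Category.assoc, Category.assoc, h.comm, ← Category.assoc, hxy, Category.assoc]

theorem IsWidePullback.sum_comp_base (h : IsWidePullback f q s φ) (S : AdditiveBundleData q)
    (P : FibrePower s 2) (j : J) : S.sum (P.proj 0 ≫ φ j) (P.proj 1 ≫ φ j)
      (h.comp_proj_eq (P.proj_comp_eq 0 1) j) ≫ q = P.base ≫ f := by
  rw [S.sum_comp, Category.assoc, h.comm, ← Category.assoc, P.proj_comp]

theorem AdditiveBundleData.zero_comp_base (S : AdditiveBundleData q) (f : N ⟶ M) :
    (f ≫ S.zero) ≫ q = 𝟙 N ≫ f := by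
  rw [Category.assoc, S.zero_comp, Category.comp_id, Category.id_comp]

/-- The componentwise operations on a wide pullback. -/
noncomputable def AdditiveBundleData.widePullback (S : AdditiveBundleData q)
    (h : IsWidePullback f q s φ) (pow : ∀ n, FibrePower s n) : AdditiveBundleData s where
  pow := pow
  add := h.lift (pow 2).base _ (h.sum_comp_base S (pow 2))
  zero := h.lift (𝟙 N) _ fun _ => S.zero_comp_base f
  add_comp := h.lift_base _ _ (h.sum_comp_base S (pow 2))
  zero_comp := h.lift_base _ _ fun _ => S.zero_comp_base f

theorem AdditiveBundleData.widePullback_add_proj (S : AdditiveBundleData q)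
    (h : IsWidePullback f q s φ) (pow : ∀ n, FibrePower s n) (j : J) :
    (S.widePullback h pow).add ≫ φ j = S.sum ((pow 2).proj 0 ≫ φ j) ((pow 2).proj 1 ≫ φ j)
      (h.comp_proj_eq ((pow 2).proj_comp_eq 0 1) j) :=
  h.lift_proj _ _ (h.sum_comp_base S (pow 2)) j

theorem AdditiveBundleData.widePullback_zero_proj (S : AdditiveBundleData q)
    (h : IsWidePullback f q s φ) (pow : ∀ n, FibrePower s n) (j : J) :
    (S.widePullback h pow).zero ≫ φ j = f ≫ S.zero :=
  h.lift_proj _ _ (fun _ => S.zero_comp_base f) j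

theorem AdditiveBundleData.widePullback_sum_proj (S : AdditiveBundleData q)
    (h : IsWidePullback f q s φ) (pow : ∀ n, FibrePower s n) (x y : A ⟶ W) (hxy : x ≫ s = y ≫ s)
    (j : J) : (S.widePullback h pow).sum x y hxy ≫ φ j =
      S.sum (x ≫ φ j) (y ≫ φ j) (h.comp_proj_eq hxy j) := by
  rw [AdditiveBundleData.sum, Category.assoc, S.widePullback_add_proj]
  refine (S.comp_sum _ _ _ _).trans (S.sum_congr _ ?_ ?_) <;>
    refine (Category.assoc _ _ _).symm.trans ?_
  · exact congrArg (fun z => z ≫ φ j) (FibrePower.pair_fst _ _ _ _)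
  · exact congrArg (fun z => z ≫ φ j) (FibrePower.pair_snd _ _ _ _)

/-- The componentwise additive bundle on a wide pullback. -/
noncomputable def AdditiveBundle.widePullback (S : AdditiveBundle q)
    (h : IsWidePullback f q s φ) (pow : ∀ n, FibrePower s n) : AdditiveBundle s where
  toAdditiveBundleData := S.toAdditiveBundleData.widePullback h pow
  add_comm' := by
    refine h.hom_ext ?_ fun j => ?_
    · exact (AdditiveBundleData.sum_comp _ _ _ _).trans (((pow 2).proj_comp 1).trans
        (S.toAdditiveBundleData.widePullback h pow).add_comp.symm)
    · rw [AdditiveBundleData.widePullback_sum_proj, S.sum_comm]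
      exact (S.widePullback_add_proj h pow j).symm
  zero_add' := by
    refine h.hom_ext ?_ fun j => ?_
    · rw [AdditiveBundleData.sum_comp, Category.assoc, AdditiveBundleData.zero_comp,
        Category.comp_id, Category.id_comp]
    · rw [AdditiveBundleData.widePullback_sum_proj]
      refine Eq.trans (S.sum_congr _ ?_ (Category.id_comp _)) ((S.zero_sum (φ j)).trans
        (Category.id_comp _).symm)
      rw [← Category.assoc, h.comm, Category.assoc, Category.assoc]
      exact congrArg (fun y => s ≫ y) (S.widePullback_zero_proj h pow j)
  add_assoc' := by
    refine h.hom_ext ?_ fun j => ?_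
    · simp only [AdditiveBundleData.sum_comp]
    · simp only [AdditiveBundleData.widePullback_sum_proj]
      exact S.sum_assoc _ _ _ (h.comp_proj_eq ((pow 3).proj_comp_eq 0 1) j)
        (h.comp_proj_eq ((pow 3).proj_comp_eq 1 2) j)

theorem AdditiveBundle.widePullback_proj (S : AdditiveBundle q) (h : IsWidePullback f q s φ)
    (pow : ∀ n, FibrePower s n) (j : J) :
    IsAdditiveMorphism (S.widePullback h pow) S (φ j) f where
  comm := (h.comm j).symm
  zero_comp := S.widePullback_zero_proj h pow j
  add_comp := S.widePullback_add_proj h pow j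

/-- A summand may be recognised as zero by any factorisation through the zero section: the morphism
`n` is then forced to be the image of the summand in the base. -/
theorem AdditiveBundle.zero_sum_of_eq (S : AdditiveBundle q) {x y : A ⟶ E} {n : A ⟶ M}
    (hx : x = n ≫ S.zero) (hxy : x ≫ q = y ≫ q) : S.sum x y hxy = y := by
  refine Eq.trans (S.sum_congr _ ?_ rfl) (S.zero_sum y)
  rw [← Category.assoc, ← hxy, hx]
  simp only [Category.assoc]
  rw [← Category.assoc S.zero, S.zero_comp, Category.id_comp]

theorem AdditiveBundle.sum_zero_of_eq (S : AdditiveBundle q) {x y : A ⟶ E} {n : A ⟶ M}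
    (hy : y = n ≫ S.zero) (hxy : x ≫ q = y ≫ q) : S.sum x y hxy = x :=
  (S.sum_comm _ _ _).trans (S.zero_sum_of_eq hy _)

end AdditiveBundlesOnLimits

/-! ### Linear morphisms are additive -/

section Linear

variable {X : Type u} [Category.{v} X] [TangentCategory X]

namespace DifferentialBundle

variable {E M A : X} {q : E ⟶ M}

theorem lift_map_proj (D : DifferentialBundle q) : D.lift ≫ T.map q = q ≫ zer M :=
  D.lift_additive_zer.comm.symm

theorem zero_lift (D : DifferentialBundle q) : D.zero ≫ D.lift = D.zero ≫ zer E :=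
  D.lift_additive_zero.zero_comp

/-- The lift of a differential bundle is a monomorphism. -/
theorem lift_injective (D : DifferentialBundle q) {x y : A ⟶ E} (h : x ≫ D.lift = y ≫ D.lift) :
    x = y := by
  -- The lift followed by T(q) is q 0, and 0 is a section of p, so the lift determines the image in
  -- the base.
  have hq : x ≫ q = y ≫ q := by
    have := congrArg (fun z => z ≫ T.map q ≫ p M) h
    simpa [← Category.assoc _ (T.map q), lift_map_proj, zer_p, Category.assoc] using this
  have hz : ∀ z : A ⟶ E, z ≫ q = (z ≫ q ≫ D.zero) ≫ q := fun z => by simp [D.zero_comp]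
  -- The lift is μ with zero as second argument, so the uniqueness part of universality applies to
  -- it.
  have key : ∀ z : A ⟶ E, (D.pow 2).pair z (z ≫ q ≫ D.zero) (hz z) ≫ D.μ = z ≫ D.lift := by
    intro z
    rw [μ, mu, AdditiveBundleData.comp_sum]
    refine ((D.toAdditiveBundle.image T D.tangential).sum_zero_of_eq (n := z ≫ q ≫ zer M) ?_
      _).trans ?_
    · rw [← Category.assoc, FibrePower.pair_snd, Category.assoc, Category.assoc, zer_natural]
      simp only [Category.assoc]
      rfl
    · rw [← Category.assoc, FibrePower.pair_fst]
  have hμ : (D.pow 2).pair x (x ≫ q ≫ D.zero) (hz x) =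
      (D.pow 2).pair y (y ≫ q ≫ D.zero) (hz y) := by
    refine (D.universal 0).hom_ext ((key x).trans (h.trans (key y).symm)) ?_
    change _ ≫ (D.pow 2).base = _ ≫ (D.pow 2).base
    rw [← (D.pow 2).proj_comp 0, ← Category.assoc, FibrePower.pair_fst, hq, ← Category.assoc,
      FibrePower.pair_fst]
  have := congrArg (fun z => z ≫ (D.pow 2).proj 0) hμ
  simpa only [FibrePower.pair_fst] using this

end DifferentialBundle

/-- Linear morphisms of differential bundles are additive. -/
theorem IsLinear.additive {E M F N : X} {q : E ⟶ M} {r : F ⟶ N} {D : DifferentialBundle q}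
    {R : DifferentialBundle r} {g : E ⟶ F} {f : M ⟶ N} (h : IsLinear D R g f) :
    IsAdditiveMorphism D.toAdditiveBundle R.toAdditiveBundle g f where
  comm := h.comm
  zero_comp := by
    -- Since q ζ = λ p, the zero section is visible through the lift once it is preceded by q;
    -- afterwards q is cancelled by its section ζ.
    have h₁ : q ≫ D.zero ≫ g = q ≫ f ≫ R.zero := by
      rw [← Category.assoc, ← D.lift_p, Category.assoc, ← p_natural, ← Category.assoc,
        h.lift_comp, Category.assoc, R.lift_p, ← Category.assoc, ← h.comm, Category.assoc]
    have h₂ := congrArg (fun z => D.zero ≫ z) h₁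
    simpa [← Category.assoc _ q, D.zero_comp] using h₂
  add_comp := by
    -- After the monic lift of the target, the sum is moved into the tangent bundle, where T(g) is
    -- additive by naturality of +.
    refine R.lift_injective ?_
    rw [Category.assoc, ← h.lift_comp, R.lift_additive_zero.sum_comp, ← Category.assoc,
      D.lift_additive_zero.add_comp, (natural g).sum_comp]
    refine AdditiveBundleData.sum_congr _ _ ?_ ?_ <;> simp [h.lift_comp]

end Linear

/-! ### Naturality of `mu` -/

section LiftMorphism

variable {X : Type u} [Category.{v} X] [AdditiveBundleStructure X] {E M F N : X} {q : E ⟶ M}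
  {r : F ⟶ N}

theorem mu_comp_map_proj (S : AdditiveBundle q) (hS : S.IsTangential T) (lam : E ⟶ T.obj E)
    (h : lam ≫ T.map q = q ≫ zer M) : mu S hS lam h ≫ T.map q = (S.pow 2).base ≫ zer M := by
  rw [mu, AdditiveBundleData.sum_comp, Category.assoc, h, ← Category.assoc, FibrePower.proj_comp]

/-- T(g) preserves the sum that defines μ, the lifts agree by `hl`, and the zero parts agree by
naturality of 0. Applied to projections, this computes the components of μ for a bundle on a limit.
-/
theorem mu_comp_map (S : AdditiveBundle q) (hS : S.IsTangential T) (lam : E ⟶ T.obj E)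
    (h : lam ≫ T.map q = q ≫ zer M) (R : AdditiveBundle r) (hR : R.IsTangential T)
    (lam' : F ⟶ T.obj F) (h' : lam' ≫ T.map r = r ≫ zer N) {g : E ⟶ F} {f : M ⟶ N}
    (hg : IsAdditiveMorphism S R g f) (hl : lam ≫ T.map g = g ≫ lam') :
    mu S hS lam h ≫ T.map g = (R.pow 2).pair ((S.pow 2).proj 0 ≫ g) ((S.pow 2).proj 1 ≫ g)
      (hg.comp_eq ((S.pow 2).proj_comp_eq 0 1)) ≫ mu R hR lam' h' := by
  rw [mu, (hg.map T hS.preserves hR.preserves).sum_comp, mu, AdditiveBundleData.comp_sum]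
  refine AdditiveBundleData.sum_congr _ _ ?_ ?_
  · rw [← Category.assoc, FibrePower.pair_fst, Category.assoc, hl, Category.assoc]
  · rw [← Category.assoc, FibrePower.pair_snd, Category.assoc, ← zer_natural, Category.assoc]

end LiftMorphism

/-! ### Componentwise differential bundles on wide pullbacks -/

section DifferentialBundlesOnLimits

variable {X : Type u} [Category.{v} X] [TangentCategory X] {J : Type w} {E M N W : X}
  {f : N ⟶ M} {q : E ⟶ M} {s : W ⟶ N} {φ : J → (W ⟶ E)}

theorem zer_ℓ (M : X) : zer M ≫ ℓ M = zer M ≫ T.map (zer M) := (ℓ_additive M).zero_comp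

namespace DifferentialBundle

theorem lift_comp_base (D : DifferentialBundle q) (h : IsWidePullback f q s φ) (j : J) :
    (φ j ≫ D.lift) ≫ T.map q = (s ≫ zer N) ≫ T.map f := by
  rw [Category.assoc, D.lift_map_proj, ← Category.assoc, h.comm, Category.assoc, Category.assoc,
    zer_natural]

/-- The componentwise lift on a wide pullback. -/
noncomputable def limitLift (D : DifferentialBundle q) (h : IsTangentialWidePullback T f q s φ) :
    W ⟶ T.obj W :=
  h.map.lift (s ≫ zer N) _ (D.lift_comp_base h.isWidePullback)

@[simp]
theorem limitLift_base (D : DifferentialBundle q) (h : IsTangentialWidePullback T f q s φ) :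
    D.limitLift h ≫ T.map s = s ≫ zer N :=
  h.map.lift_base _ _ (D.lift_comp_base h.isWidePullback)

@[simp]
theorem limitLift_proj (D : DifferentialBundle q) (h : IsTangentialWidePullback T f q s φ)
    (j : J) : D.limitLift h ≫ T.map (φ j) = φ j ≫ D.lift :=
  h.map.lift_proj _ _ (D.lift_comp_base h.isWidePullback) j

variable (D : DifferentialBundle q) (h : IsTangentialWidePullback T f q s φ)
  (pow : ∀ n, FibrePower s n)
  (hpow : ∀ n, IsTangentialFibreProduct T (fun _ : Fin n => s) (pow n).base (pow n).proj)

theorem isTangential_widePullback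
    (hpow : ∀ n, IsTangentialFibreProduct T (fun _ : Fin n => s) (pow n).base (pow n).proj) :
    (D.toAdditiveBundle.widePullback h.isWidePullback pow).IsTangential T := hpow

theorem limitLift_additive_zer :
    IsAdditiveMorphism (D.toAdditiveBundle.widePullback h.isWidePullback pow)
      ((D.toAdditiveBundle.widePullback h.isWidePullback pow).image T
        (D.isTangential_widePullback h pow hpow)) (D.limitLift h) (zer N) where
  comm := (D.limitLift_base h).symm
  zero_comp := by
    have hz := (D.toAdditiveBundle.widePullback h.isWidePullback pow).zero_comp
    refine h.map.hom_ext ?_ fun j => ?_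
    · rw [Category.assoc, limitLift_base, ← Category.assoc, hz, Category.id_comp, Category.assoc]
      exact ((congrArg (fun y => zer N ≫ y) ((T.map_comp _ _).symm.trans
        ((congrArg T.map hz).trans (T.map_id _)))).trans (Category.comp_id _)).symm
    · have hz' := (D.toAdditiveBundle.widePullback_proj h.isWidePullback pow j).zero_comp
      rw [Category.assoc, limitLift_proj, ← Category.assoc, hz', Category.assoc, D.zero_lift,
        zer_natural, ← Category.assoc, zer_natural, Category.assoc, Category.assoc]
      refine congrArg (fun y => zer N ≫ y) ?_
      exact ((T.map_comp _ _).symm.trans (congrArg T.map hz'.symm)).trans (T.map_comp _ _)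
  add_comp := by
    refine h.map.hom_ext ?_ fun j => ?_
    · refine Eq.trans ?_ (AdditiveBundleData.sum_comp _ _ _ _).symm
      rw [Category.assoc, Category.assoc, limitLift_base, ← Category.assoc, ← Category.assoc,
        AdditiveBundleData.add_comp, FibrePower.proj_comp]
    · have ha := D.toAdditiveBundle.widePullback_proj h.isWidePullback pow j
      refine Eq.trans ?_ ((ha.map T (D.isTangential_widePullback h pow hpow).preserves
        D.tangential.preserves).sum_comp _ _ _).symm
      rw [Category.assoc, limitLift_proj, ← Category.assoc, ha.add_comp,
        D.lift_additive_zer.sum_comp]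
      exact AdditiveBundleData.sum_congr _ _ (by simp) (by simp)

theorem limitLift_additive_zero :
    IsAdditiveMorphism (D.toAdditiveBundle.widePullback h.isWidePullback pow) (bundle W)
      (D.limitLift h) (D.toAdditiveBundle.widePullback h.isWidePullback pow).zero where
  comm := by
    refine h.isWidePullback.hom_ext ?_ fun j => ?_
    · rw [Category.assoc, AdditiveBundleData.zero_comp, Category.comp_id, Category.assoc,
        ← p_natural, ← Category.assoc, limitLift_base, Category.assoc, zer_p, Category.comp_id]
    · have hz' := (D.toAdditiveBundle.widePullback_proj h.isWidePullback pow j).zero_comp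
      rw [Category.assoc, hz', Category.assoc, ← p_natural, ← Category.assoc (D.limitLift h),
        limitLift_proj, Category.assoc, D.lift_p, ← Category.assoc, ← Category.assoc,
        h.isWidePullback.comm]
  zero_comp := by
    refine h.map.hom_ext ?_ fun j => ?_
    · rw [Category.assoc, limitLift_base, Category.assoc]
      exact congrArg (fun y => _ ≫ y) (zer_natural s)
    · have hz' := (D.toAdditiveBundle.widePullback_proj h.isWidePullback pow j).zero_comp
      rw [Category.assoc, limitLift_proj, ← Category.assoc, hz', Category.assoc, D.zero_lift,
        Category.assoc]
      refine Eq.trans ?_ (congrArg (fun y => _ ≫ y) (zer_natural (φ j)))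
      rw [← Category.assoc, ← Category.assoc, hz']
  add_comp := by
    refine h.map.hom_ext ?_ fun j => ?_
    · refine Eq.trans ?_ ((natural s).sum_comp _ _ _).symm
      refine Eq.trans ?_ ((bundle N).sum_zero_of_eq (n := (pow 2).base) ?_ _).symm
      · rw [Category.assoc, Category.assoc, limitLift_base, ← Category.assoc, ← Category.assoc,
          AdditiveBundleData.add_comp, FibrePower.proj_comp]
      · rw [Category.assoc, limitLift_base, ← Category.assoc, FibrePower.proj_comp]
        rfl
    · have ha := D.toAdditiveBundle.widePullback_proj h.isWidePullback pow j
      refine Eq.trans ?_ ((natural (φ j)).sum_comp _ _ _).symm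
      rw [Category.assoc, limitLift_proj, ← Category.assoc, ha.add_comp,
        D.lift_additive_zero.sum_comp]
      exact AdditiveBundleData.sum_congr _ _ (by simp) (by simp)

/-- The equation lives in T²W, so it is tested on components by means of the second iterate of `T`.
-/
theorem limitLift_lift : D.limitLift h ≫ ℓ W = D.limitLift h ≫ T.map (D.limitLift h) := by
  refine h.map_map.hom_ext ?_ fun j => ?_
  · rw [Category.assoc, Category.assoc, ← ℓ_natural, ← Category.assoc, limitLift_base,
      Category.assoc, zer_ℓ, ← T.map_comp, limitLift_base, T.map_comp, ← Category.assoc,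
      ← Category.assoc, limitLift_base]
  · rw [Category.assoc, Category.assoc, ← ℓ_natural, ← Category.assoc, limitLift_proj,
      Category.assoc, D.lift_lift, ← T.map_comp, limitLift_proj, T.map_comp, ← Category.assoc,
      ← Category.assoc, limitLift_proj]

/-- Limits commute with limits: the universality square of the limit is assembled from those of the
factors. The morphism `m` plays the part of μ and is known only through its components, where `d j`
applies `φ j` to both entries of a pair. -/
theorem isTangentialPullback_of_limit (D : DifferentialBundle q)
    (h : IsTangentialWidePullback T f q s φ) {P : FibrePower s 2}
    (hP : IsTangentialFibreProduct T (fun _ : Fin 2 => s) P.base P.proj) {m : P.obj ⟶ T.obj W}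
    {d : J → (P.obj ⟶ (D.pow 2).obj)} (hd : ∀ i j, d j ≫ (D.pow 2).proj i = P.proj i ≫ φ j)
    (hms : m ≫ T.map s = P.base ≫ zer N) (hmφ : ∀ j, m ≫ T.map (φ j) = d j ≫ D.μ) :
    IsTangentialPullback T m P.base (T.map s) (zer N) := by
  intro k
  have hpow₂ := isFibreProduct_iff_isWidePullback.1 (hP k)
  have hD : ∀ j, (iter T k).map ((D.pow 2).proj j) ≫ (iter T k).map q =
      (iter T k).map (D.pow 2).base := fun j => by rw [← Functor.map_comp, FibrePower.proj_comp]
  have hDpow := isFibreProduct_iff_isWidePullback.1 (D.tangential 2 k)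
  have ext₂ : ∀ {A : X} {x y : A ⟶ (iter T k).obj P.obj},
      x ≫ (iter T k).map P.base = y ≫ (iter T k).map P.base →
      (∀ j, x ≫ (iter T k).map (d j) = y ≫ (iter T k).map (d j)) → x = y := by
    intro A x y hxy hxy'
    refine hpow₂.hom_ext hxy fun i => (h k).hom_ext ?_ fun j => ?_
    · rw [Category.assoc, Category.assoc, ← Functor.map_comp, P.proj_comp, hxy]
    · have h₀ := congrArg (fun z => z ≫ (iter T k).map ((D.pow 2).proj i)) (hxy' j)
      simp only [Category.assoc, ← Functor.map_comp] at h₀ ⊢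
      simpa only [hd] using h₀
  have key : ∀ {A : X} (z : A ⟶ (iter T k).obj (T.obj W)) (n : A ⟶ (iter T k).obj N),
      z ≫ (iter T k).map (T.map s) = n ≫ (iter T k).map (zer N) →
      ∃ y : A ⟶ (iter T k).obj P.obj,
        y ≫ (iter T k).map m = z ∧ y ≫ (iter T k).map P.base = n := by
    intro A z n hzn
    -- Each component of `z` lies over a zero vector of `M`, so it is a value of μ for `D`.
    have hy : ∀ j, ∃ y : A ⟶ (iter T k).obj (D.pow 2).obj,
        y ≫ (iter T k).map D.μ = z ≫ (iter T k).map (T.map (φ j)) ∧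
        y ≫ (iter T k).map (D.pow 2).base = n ≫ (iter T k).map f := by
      intro j
      have hc : (z ≫ (iter T k).map (T.map (φ j))) ≫ (iter T k).map (T.map q) =
          (n ≫ (iter T k).map f) ≫ (iter T k).map (zer M) := by
        rw [Category.assoc, ← Functor.map_comp, ← Functor.map_comp, h.isWidePullback.comm,
          Functor.map_comp, Functor.map_comp, ← Category.assoc, hzn, Category.assoc,
          Category.assoc, ← Functor.map_comp, ← Functor.map_comp, zer_natural]
      exact ⟨(D.universal k).lift _ _ hc, (D.universal k).lift_fst _ _ hc,
        (D.universal k).lift_snd _ _ hc⟩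
    choose y hy hy' using hy
    -- The family of pairs `y j` is regrouped into a pair of families, that is, into two elements of
    -- `W` over `n`.
    let u : Fin 2 → (A ⟶ (iter T k).obj W) := fun i =>
      (h k).lift n (fun j => y j ≫ (iter T k).map ((D.pow 2).proj i)) fun j => by
        rw [Category.assoc, hD, hy']
    have hu : ∀ i, u i ≫ (iter T k).map s = n := fun i => (h k).lift_base _ _ _
    have hu' : ∀ i j, u i ≫ (iter T k).map (φ j) = y j ≫ (iter T k).map ((D.pow 2).proj i) :=
      fun i j => (h k).lift_proj n (fun j => y j ≫ (iter T k).map ((D.pow 2).proj i)) _ j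
    obtain ⟨x, hx, hx'⟩ := hpow₂.exists_lift n u fun i => by rw [hu, Category.comp_id]
    have hxd : ∀ j, x ≫ (iter T k).map (d j) = y j := by
      intro j
      refine hDpow.hom_ext ?_ fun i => ?_
      · rw [hy', Category.assoc, ← Functor.map_comp, ← (D.pow 2).proj_comp 0, ← Category.assoc,
          hd, Category.assoc, h.isWidePullback.comm, ← Category.assoc, P.proj_comp,
          Functor.map_comp, ← Category.assoc, hx]
      · rw [Category.assoc, ← Functor.map_comp, ← hu', ← hx', Category.assoc,
          ← Functor.map_comp]
        rw [hd]
    -- The target of `z` is the k-th iterate at T W, hence the iterate k + 1 at `W`.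
    refine ⟨x, IsWidePullback.hom_ext (h (k + 1)) ?_ fun j => ?_, hx⟩
    · change (x ≫ (iter T k).map m) ≫ (iter T k).map (T.map s) = z ≫ (iter T k).map (T.map s)
      rw [Category.assoc, ← Functor.map_comp, hms, Functor.map_comp, ← Category.assoc, hx, hzn]
    · change (x ≫ (iter T k).map m) ≫ (iter T k).map (T.map (φ j)) =
        z ≫ (iter T k).map (T.map (φ j))
      rw [Category.assoc, ← Functor.map_comp, hmφ, Functor.map_comp, ← Category.assoc, hxd, hy]
  choose l hl hl' using @key
  refine ⟨⟨by rw [← Functor.map_comp, hms, Functor.map_comp]⟩, ⟨PullbackCone.IsLimit.mk _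
    (fun c => l c.fst c.snd c.condition) (fun c => hl _ _ _) (fun c => hl' _ _ _)
    fun c x h₀ h₁ => ext₂ (h₁.trans (hl' _ _ _).symm) fun j => ?_⟩⟩
  have h₂ : x ≫ (iter T k).map m = l c.fst c.snd c.condition ≫ (iter T k).map m :=
    h₀.trans (hl _ _ _).symm
  have h₃ : x ≫ (iter T k).map P.base = l c.fst c.snd c.condition ≫
    (iter T k).map P.base := h₁.trans (hl' _ _ _).symm
  refine (D.universal k).hom_ext ?_ ?_
  · change (x ≫ (iter T k).map (d j)) ≫ (iter T k).map D.μ = (_ ≫ _) ≫ (iter T k).map D.μ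
    rw [Category.assoc, Category.assoc, ← Functor.map_comp, ← hmφ, Functor.map_comp,
      ← Category.assoc, h₂, Category.assoc]
  · have hb : d j ≫ (D.pow 2).base = P.base ≫ f := by
      rw [← (D.pow 2).proj_comp 0, ← Category.assoc, hd, Category.assoc,
        h.isWidePullback.comm, ← Category.assoc, P.proj_comp]
    rw [Category.assoc, Category.assoc, ← Functor.map_comp, hb, Functor.map_comp,
      ← Category.assoc, h₃, Category.assoc]

theorem limitLift_universal :
    IsTangentialPullback T
      (mu (D.toAdditiveBundle.widePullback h.isWidePullback pow)
        (D.isTangential_widePullback h pow hpow) (D.limitLift h) (D.limitLift_base h))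
      (pow 2).base (T.map s) (zer N) := by
  refine D.isTangentialPullback_of_limit h (hpow 2) (fun i j => ?_) (mu_comp_map_proj _ _ _ _)
    fun j => mu_comp_map _ _ _ _ _ _ _ _ (D.toAdditiveBundle.widePullback_proj h.isWidePullback pow j)
      (D.limitLift_proj h j)
  fin_cases i
  · exact FibrePower.pair_fst _ _ _ _
  · exact FibrePower.pair_snd _ _ _ _

/-- The componentwise differential bundle on a wide pullback. -/
noncomputable def widePullback : DifferentialBundle s where
  toAdditiveBundle := D.toAdditiveBundle.widePullback h.isWidePullback pow
  lift := D.limitLift h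
  tangential := D.isTangential_widePullback h pow hpow
  lift_additive_zer := D.limitLift_additive_zer h pow hpow
  lift_additive_zero := D.limitLift_additive_zero h pow
  universal := D.limitLift_universal h pow hpow
  lift_lift := D.limitLift_lift h

theorem widePullback_proj (j : J) : IsLinear (D.widePullback h pow hpow) D (φ j) f where
  comm := (h.isWidePullback.comm j).symm
  lift_comp := D.limitLift_proj h j

end DifferentialBundle

end DifferentialBundlesOnLimits

/-! ### Existence of bundles on limits, and cartesian arrows -/

section Existence

variable {X : Type u} [Category.{v} X] [TangentCategory X] {J : Type w} {E M N W : X}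
  {f : N ⟶ M} {q : E ⟶ M} {s : W ⟶ N} {φ : J → (W ⟶ E)}

namespace DifferentialBundle

/-- If `f` has wide pullbacks with all finite powers of a differential bundle, then each of these
wide pullbacks underlies a differential bundle. -/
theorem exists_widePullback [Finite J] (D : DifferentialBundle q)
    (h : IsTangentialWidePullback T f q s φ)
    (hf : ∀ n : ℕ, ∃ (V : X) (t : V ⟶ N) (ψ : Fin n → (V ⟶ E)),
      IsTangentialWidePullback T f q t ψ) :
    ∃ P : DifferentialBundle s, ∀ j, IsLinear P D (φ j) f := by
  have hpow : ∀ n : ℕ, ∃ P : FibrePower s n,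
      IsTangentialFibreProduct T (fun _ : Fin n => s) P.base P.proj := by
    intro n
    -- The n-th fibre power of `W` over `N` is the wide pullback with one copy of `E` for each
    -- element of `Fin n × J`.
    obtain ⟨V, t, ψ, hψ⟩ := hf (Nat.card (Fin n × J))
    have hψ' := hψ.reindex (Finite.equivFin (Fin n × J))
    let π : Fin n → (V ⟶ W) := fun i => h.isWidePullback.lift t
      (fun j => ψ (Finite.equivFin (Fin n × J) (i, j))) fun j => hψ.isWidePullback.comm _
    have hπ := h.isTangentialFibreProduct_of_prod hψ' π
      (fun i => h.isWidePullback.lift_base _ _ _) fun i j => h.isWidePullback.lift_proj t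
        (fun j => ψ (Finite.equivFin (Fin n × J) (i, j))) _ j
    exact ⟨⟨V, t, π, hπ 0⟩, hπ⟩
  choose pow hpow using hpow
  exact ⟨D.widePullback h pow hpow, D.widePullback_proj h pow hpow⟩

theorem isTangentialWidePullback_pow (D : DifferentialBundle q) (n : ℕ) :
    IsTangentialWidePullback T (𝟙 M) q (D.pow n).base (D.pow n).proj :=
  isTangentialFibreProduct_iff.1 (D.tangential n)

/-- A tangential fibre product of instances of a differential bundle underlies a differential
bundle. -/
theorem exists_fibreProduct [Finite J] {b : W ⟶ M} {π : J → (W ⟶ E)} (D : DifferentialBundle q)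
    (h : IsTangentialWidePullback T (𝟙 M) q b π) :
    ∃ P : DifferentialBundle b, ∀ j, IsLinear P D (π j) (𝟙 M) :=
  D.exists_widePullback h fun n => ⟨_, _, _, D.isTangentialWidePullback_pow n⟩

/-- The pullback of a differential bundle along its own projection. -/
theorem exists_selfPullback {π : Fin 2 → (W ⟶ E)} {b : W ⟶ M} (D : DifferentialBundle q)
    (h : IsTangentialWidePullback T (𝟙 M) q b π) (i j : Fin 2) (hij : i ≠ j) :
    ∃ P : DifferentialBundle (π i), IsLinear P D (π j) q ∧
      IsTangentialWidePullback T q q (π i) (fun _ : Unit => π j) := by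
  have h' : IsTangentialWidePullback T q q (π i) (fun _ : Unit => π j) := by
    -- `Fin 2` has only one index different from `i`.
    have hj : ∀ k : Fin 1, π (i.succAbove k) = π j := by
      intro k
      have := Fin.succAbove_ne i k
      congr 1
      lia
    have := (h.split i).reindex (Equiv.ofUnique Unit (Fin 1))
    simpa only [hj] using this
  -- The n-fold wide pullback along `q` is the fibre power of order n + 1, regarded over its factor
  -- 0.
  obtain ⟨P, hP⟩ := D.exists_widePullback h' fun n =>
    ⟨_, _, _, (D.isTangentialWidePullback_pow (n + 1)).split 0⟩
  exact ⟨P, hP (), h'⟩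

end DifferentialBundle

/-- Linearity of a morphism into a limit can be checked on components. -/
theorem IsTangentialWidePullback.isLinear {E' N' : X} {q' : E' ⟶ N'} {D : DifferentialBundle q}
    {P : DifferentialBundle s} {R : DifferentialBundle q'} (h : IsTangentialWidePullback T f q s φ)
    (hP : ∀ j, IsLinear P D (φ j) f) {g : E' ⟶ W} {n : N' ⟶ N} (hg : q' ≫ n = g ≫ s)
    (hφ : ∀ j, IsLinear R D (g ≫ φ j) (n ≫ f)) : IsLinear R P g n where
  comm := hg
  lift_comp := by
    refine h.map.hom_ext ?_ fun j => ?_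
    · rw [Category.assoc, Category.assoc, ← T.map_comp, ← hg, T.map_comp, P.lift_map_proj,
        ← Category.assoc, R.lift_map_proj, ← Category.assoc g, ← hg, Category.assoc,
        Category.assoc, zer_natural]
    · rw [Category.assoc, Category.assoc, ← T.map_comp, (hφ j).lift_comp, (hP j).lift_comp,
        Category.assoc]

theorem DBun.Hom.bot_eq {A B : DBun X} {g : A.base ⟶ B.base} {ψ : A ⟶ B}
    (h : (cod X).IsHomLift g ψ) : g = DBun.Hom.bot ψ :=
  @IsHomLift.eq_of_isHomLift _ _ _ _ (cod X) A B g ψ h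

/-- A linear morphism whose underlying square is a tangential pullback is cartesian. -/
theorem IsLinear.isPullbackBundle {φ : W ⟶ E} {P : DifferentialBundle s} {D : DifferentialBundle q}
    (hl : IsLinear P D φ f) (h : IsTangentialPullback T φ s q f) : IsPullbackBundle P D φ f := by
  refine ⟨hl, ?_⟩
  have hl₀ : (cod X).IsHomLift f (⟨φ, f, hl⟩ : DBun.Hom (DBun.of P) (DBun.of D)) :=
    IsHomLift.map (cod X) (⟨φ, f, hl⟩ : (DBun.of P) ⟶ (DBun.of D))
  refine ⟨fun {A} g ψ hψ => ?_⟩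
  change A.base ⟶ N at g
  have hbot : g ≫ f = DBun.Hom.bot ψ := DBun.Hom.bot_eq hψ
  have hψl := DBun.Hom.linear ψ
  have hc : DBun.Hom.top ψ ≫ q = (A.proj ≫ g) ≫ f := by
    rw [Category.assoc, hbot]
    exact hψl.comm.symm
  have h₀ : IsPullback φ s q f := h 0
  -- The pullback `h₀` gives the mediating morphism, and its image under `T` is what allows its
  -- linearity to be checked on the two legs.
  have h₁ : IsPullback (T.map φ) (T.map s) (T.map q) (T.map f) := h 1
  have hx : IsLinear A.bundle P (h₀.lift _ _ hc) g := by
    refine ⟨(h₀.lift_snd _ _ hc).symm, h₁.hom_ext ?_ ?_⟩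
    · rw [Category.assoc, Category.assoc, ← T.map_comp, h₀.lift_fst, hl.lift_comp,
        ← Category.assoc, h₀.lift_fst]
      exact hψl.lift_comp
    · rw [Category.assoc, Category.assoc, ← T.map_comp, h₀.lift_snd, P.lift_map_proj,
        ← Category.assoc _ s, h₀.lift_snd, T.map_comp, ← Category.assoc,
        A.bundle.lift_map_proj, Category.assoc, Category.assoc, zer_natural]
  refine ⟨(⟨_, g, hx⟩ : DBun.Hom A (DBun.of P)), ⟨?_, ?_⟩, ?_⟩
  · exact IsHomLift.map (cod X) (⟨_, g, hx⟩ : A ⟶ DBun.of P)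
  · exact DBun.Hom.ext (h₀.lift_fst _ _ hc) hbot
  · rintro y ⟨hy, hy'⟩
    have hyb : g = DBun.Hom.bot y := DBun.Hom.bot_eq hy
    refine DBun.Hom.ext (h₀.hom_ext ?_ ?_) hyb.symm
    · exact (congrArg DBun.Hom.top hy').trans (h₀.lift_fst _ _ hc).symm
    · refine (DBun.Hom.linear y).comm.symm.trans ?_
      rw [← hyb]
      exact (h₀.lift_snd _ _ hc).symm

end Existence

/-! ### Products and biproducts of differential bundles -/

section Biproducts

variable {X : Type u} [Category.{v} X] [TangentCategory X] {M : X}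

namespace DBunOver

variable {A B C : DBunOver M}

theorem comp_add (f : A ⟶ B) (g h : B ⟶ C) : f ≫ (g + h) = f ≫ g + f ≫ h :=
  DBunOver.Hom.ext (C.bundle.comp_sum _ _ _ _)

/-- This side of bilinearity is where additivity of linear morphisms enters, as `IsLinear` only
demands compatibility with the lifts. -/
theorem add_comp (f g : A ⟶ B) (h : B ⟶ C) : (f + g) ≫ h = f ≫ h + g ≫ h :=
  DBunOver.Hom.ext ((DBunOver.Hom.linear h).additive.sum_comp _ _ _)

theorem comp_zero (f : A ⟶ B) : f ≫ (0 : B ⟶ C) = 0 :=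
  DBunOver.Hom.ext ((Category.assoc _ _ _).symm.trans
    (congrArg (fun y => y ≫ C.bundle.zero) (DBunOver.Hom.w f)))

theorem zero_comp (f : B ⟶ C) : (0 : A ⟶ B) ≫ f = 0 :=
  DBunOver.Hom.ext ((Category.assoc _ _ _).trans (congrArg (fun y => A.proj ≫ y)
    ((DBunOver.Hom.linear f).additive.zero_comp.trans (Category.id_comp _))))

theorem comp_sum {I : Type w} (S : Finset I) (f : A ⟶ B) (g : I → (B ⟶ C)) :
    f ≫ ∑ i ∈ S, g i = ∑ i ∈ S, f ≫ g i :=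
  map_sum (⟨⟨fun g => f ≫ g, comp_zero f⟩, comp_add f⟩ : (B ⟶ C) →+ (A ⟶ C)) g S

theorem sum_comp {I : Type w} (S : Finset I) (f : I → (A ⟶ B)) (g : B ⟶ C) :
    (∑ i ∈ S, f i) ≫ g = ∑ i ∈ S, f i ≫ g :=
  map_sum (⟨⟨fun f => f ≫ g, zero_comp g⟩, fun f h => add_comp f h g⟩ : (A ⟶ B) →+ (A ⟶ C)) f S

end DBunOver

variable {I : Type w} [Fintype I] {Q : I → DBunOver M} {F : DBunOver M} {π : ∀ i, F ⟶ Q i}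

theorem IsBiproduct.isProduct {ι : ∀ i, Q i ⟶ F} (h : IsBiproduct π ι) : IsProduct π := by
  refine ⟨Fan.IsLimit.mk _ (fun c => ∑ i, c.proj i ≫ ι i) (fun c j => ?_) fun c m hm => ?_⟩
  · refine (DBunOver.sum_comp _ _ (π j)).trans ?_
    rw [Finset.sum_eq_single j]
    · rw [Category.assoc, h.inj_proj_self, Category.comp_id]
    · intro i _ hij
      rw [Category.assoc, h.inj_proj_ne i j hij, DBunOver.comp_zero]
    · simp
  · have := (DBunOver.comp_sum Finset.univ m fun i => π i ≫ ι i).symm.trans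
      ((congrArg (fun y => m ≫ y) h.sum_eq).trans (Category.comp_id m))
    refine this.symm.trans ?_
    exact Finset.sum_congr rfl fun i _ => by rw [← Category.assoc]; exact congrArg (· ≫ ι i) (hm i)

/-- The remaining equation, that the sum of the π i ι i is the identity, may be tested after each
projection. -/
theorem isBiproduct_of_isProduct {ι : ∀ i, Q i ⟶ F} (h : IsProduct π)
    (h₀ : ∀ i, ι i ≫ π i = 𝟙 (Q i)) (h₁ : ∀ i j, i ≠ j → ι i ≫ π j = 0) : IsBiproduct π ι := by
  obtain ⟨hl⟩ := h
  refine ⟨h₀, h₁, Fan.IsLimit.hom_ext hl _ _ fun j => ?_⟩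
  refine (DBunOver.sum_comp _ _ (π j)).trans (Eq.trans ?_ (Category.id_comp (π j)).symm)
  rw [Finset.sum_eq_single j, Category.assoc, h₀,
    Category.comp_id]
  · intro i _ hij
    rw [Category.assoc, h₁ i j hij, DBunOver.comp_zero]
  · simp

theorem IsProduct.exists_isBiproduct (h : IsProduct π) : ∃ ι, IsBiproduct π ι := by
  classical
  obtain ⟨hl⟩ := h
  -- The injections have the Kronecker delta as components, with zero morphisms off the diagonal;
  -- `eqToHom` is an identity when i = j.
  let δ : ∀ i j, Q i ⟶ Q j := fun i j => if hij : i = j then eqToHom (congrArg Q hij) else 0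
  refine ⟨fun i => Fan.IsLimit.lift hl (δ i), isBiproduct_of_isProduct ⟨hl⟩ (fun i => ?_)
    fun i j hij => ?_⟩
  · refine (Fan.IsLimit.fac hl (δ i) i).trans ?_
    simp [δ]
  · refine (Fan.IsLimit.fac hl (δ i) j).trans ?_
    simp [δ, hij]

/-- A tangential fibre product of instances of a differential bundle is a product of differential
bundles. -/
theorem IsTangentialWidePullback.isProduct {J : Type w} {B A : DBunOver M} {π : J → (B ⟶ A)}
    (h : IsTangentialWidePullback T (𝟙 M) A.proj B.proj fun j => DBunOver.Hom.hom (π j)) :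
    IsProduct π := by
  have hl := fun (c : Fan fun _ : J => A) => h.isWidePullback.exists_lift c.pt.proj
    (fun j => DBunOver.Hom.hom (c.proj j)) fun j => by
      rw [DBunOver.Hom.w, Category.comp_id]
  choose l hl hl' using hl
  refine ⟨Fan.IsLimit.mk _ (fun c => (⟨l c, h.isLinear (fun j => DBunOver.Hom.linear (π j)) ?_ ?_⟩ :
    DBunOver.Hom c.pt B)) ?_ ?_⟩
  · rw [hl, Category.comp_id]
  · intro j
    rw [hl', Category.comp_id]
    exact DBunOver.Hom.linear (c.proj j)
  · intro c j
    exact DBunOver.Hom.ext (hl' c j)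
  · intro c m hm
    refine DBunOver.Hom.ext (h.isWidePullback.hom_ext ?_ fun j => ?_)
    · exact (DBunOver.Hom.w m).trans (hl c).symm
    · exact (congrArg DBunOver.Hom.hom (hm j)).trans (hl' c j).symm

/-- A product of three instances of a differential bundle is a fibre product. -/
theorem IsProduct.isWidePullback {A B : DBunOver M} {π : Fin 3 → (B ⟶ A)} (h : IsProduct π) :
    IsWidePullback (𝟙 M) A.proj B.proj fun j => DBunOver.Hom.hom (π j) := by
  obtain ⟨ι, hι⟩ := h.exists_isBiproduct
  -- The biproduct equation is unfolded to underlying morphisms, because it will be preceded by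
  -- morphisms from objects that carry no bundle structure.
  have hs : (B.bundle.sum (B.bundle.sum (DBunOver.Hom.hom (π 0) ≫ DBunOver.Hom.hom (ι 0))
      (DBunOver.Hom.hom (π 1) ≫ DBunOver.Hom.hom (ι 1)) (DBunOver.Hom.w_eq (π 0 ≫ ι 0) (π 1 ≫ ι 1)))
      (DBunOver.Hom.hom (π 2) ≫ DBunOver.Hom.hom (ι 2))
      (DBunOver.Hom.w_eq (π 0 ≫ ι 0 + π 1 ≫ ι 1) (π 2 ≫ ι 2))) = 𝟙 B.obj := by
    have := hι.sum_eq
    rw [Fin.sum_univ_three] at this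
    exact congrArg DBunOver.Hom.hom this
  refine ⟨fun j => ?_, fun {Y} n e he => ?_, fun {Y x y} h₀ h₁ => ?_⟩
  · rw [DBunOver.Hom.w, Category.comp_id]
  · have he' : ∀ i, (e i ≫ DBunOver.Hom.hom (ι i)) ≫ B.proj = n := fun i => by
      rw [Category.assoc, DBunOver.Hom.w, he, Category.comp_id]
    have hij : ∀ i j, i ≠ j → (e i ≫ DBunOver.Hom.hom (ι i)) ≫ DBunOver.Hom.hom (π j) =
        n ≫ A.bundle.zero := fun i j h => by
      refine (Category.assoc _ _ _).trans ((congrArg (fun y => e i ≫ y)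
        (congrArg DBunOver.Hom.hom (hι.inj_proj_ne i j h))).trans ?_)
      refine (Category.assoc _ _ _).symm.trans (congrArg (fun y => y ≫ A.bundle.zero) ?_)
      rw [he, Category.comp_id]
    have hii : ∀ i, (e i ≫ DBunOver.Hom.hom (ι i)) ≫ DBunOver.Hom.hom (π i) = e i := fun i =>
      (Category.assoc _ _ _).trans ((congrArg (fun y => e i ≫ y)
        (congrArg DBunOver.Hom.hom (hι.inj_proj_self i))).trans (Category.comp_id _))
    have h₀₁ := (he' 0).trans (he' 1).symm
    have h₀₂ := (B.bundle.sum_comp _ _ h₀₁).trans ((he' 0).trans (he' 2).symm)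
    -- The mediating morphism is e₀ι₀ + e₁ι₁ + e₂ι₂. As each projection is additive, it keeps its
    -- own summand and sends the other two to zero.
    refine ⟨B.bundle.sum (B.bundle.sum _ _ h₀₁) _ h₀₂, ?_, fun j => ?_⟩
    · rw [B.bundle.sum_comp, B.bundle.sum_comp, he']
    · have hπ := (DBunOver.Hom.linear (π j)).additive
      rw [hπ.sum_comp]
      have h₃ := hπ.sum_comp _ _ h₀₁
      fin_cases j
      · exact (A.bundle.sum_zero_of_eq (hij 2 0 (by decide)) _).trans
          (h₃.trans ((A.bundle.sum_zero_of_eq (hij 1 0 (by decide)) _).trans (hii 0)))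
      · exact (A.bundle.sum_zero_of_eq (hij 2 1 (by decide)) _).trans
          (h₃.trans ((A.bundle.zero_sum_of_eq (hij 0 1 (by decide)) _).trans (hii 1)))
      · exact (A.bundle.zero_sum_of_eq (h₃.trans ((A.bundle.zero_sum_of_eq
          (hij 0 2 (by decide)) _).trans (hij 1 2 (by decide)))) _).trans (hii 2)
  -- Uniqueness: x is the sum of the x π i ι i, so it is determined by its projections.
  · rw [← Category.comp_id x, ← Category.comp_id y, ← hs]
    have h₂ : ∀ j, x ≫ DBunOver.Hom.hom (π j) ≫ DBunOver.Hom.hom (ι j) =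
        y ≫ DBunOver.Hom.hom (π j) ≫ DBunOver.Hom.hom (ι j) := fun j => by
      rw [← Category.assoc, h₁, Category.assoc]
    refine (B.bundle.comp_sum x _ _ _).trans (Eq.trans (B.bundle.sum_congr _ ?_ (h₂ 2))
      (B.bundle.comp_sum y _ _ _).symm)
    exact (B.bundle.comp_sum x _ _ _).trans (Eq.trans (B.bundle.sum_congr _ (h₂ 0) (h₂ 1))
      (B.bundle.comp_sum y _ _ _).symm)

end Biproducts

/-! ### Partial bundles of products -/

section PartialBundles

variable {X : Type u} [Category.{v} X] [TangentCategory X] {M : X}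

/-- The arrow from `P` to the product `G` of the remaining factors is linear, and the projections of
`G` take it to the morphisms underlying the π i. -/
theorem IsPartialBundle.isLinear {I : Type w} {Q : I → DBunOver M} {F : DBunOver M}
    {π : ∀ i, F ⟶ Q i} {j : I} {s : F.obj ⟶ (Q j).obj} {P : DifferentialBundle s}
    (h : IsPartialBundle π j P) (i : I) (hi : i ≠ j) :
    IsLinear P (Q i).bundle (DBunOver.Hom.hom (π i)) (Q j).proj := by
  obtain ⟨-, G, ρ, hG, hl, -⟩ := h
  have hk := congrArg DBunOver.Hom.hom
    (Fan.IsLimit.fac hG (fun i : {i : I // i ≠ j} => π i) ⟨i, hi⟩)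
  have := hl.comp (DBunOver.Hom.linear (ρ ⟨i, hi⟩))
  rw [Category.comp_id] at this
  exact hk ▸ this

/-- For a product of instances of a differential bundle `D` that is a tangential fibre product, a
differential bundle on a projection is a partial bundle if the other projections are linear. -/
theorem IsTangentialWidePullback.isPartialBundle {n : ℕ} {B A : DBunOver M}
    {π : Fin (n + 1) → (B ⟶ A)}
    (h : IsTangentialWidePullback T (𝟙 M) A.proj B.proj fun j => DBunOver.Hom.hom (π j))
    (j : Fin (n + 1)) {s : B.obj ⟶ A.obj} (P : DifferentialBundle s)
    (hs : s = DBunOver.Hom.hom (π j))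
    (hP : ∀ i, i ≠ j → IsLinear P A.bundle (DBunOver.Hom.hom (π i)) A.proj) :
    IsPartialBundle π j P := by
  subst hs
  -- The product of the other factors is the specified n-th fibre power, with its factors renamed by
  -- the indices different from `j`.
  have hG := (A.bundle.isTangentialWidePullback_pow n).reindex (finSuccAboveEquiv j).symm
  obtain ⟨D, hD⟩ := A.bundle.exists_fibreProduct hG
  let ρ : ∀ _ : {i // i ≠ j}, DBunOver.of D ⟶ A := fun i => (⟨_, hD i⟩ : DBunOver.Hom _ _)
  have hρ : IsProduct ρ := IsTangentialWidePullback.isProduct (π := ρ) hG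
  obtain ⟨hl⟩ := hρ
  let k := Fan.IsLimit.lift hl fun i : {i // i ≠ j} => π i
  have hk : DBunOver.Hom.hom k ≫ _ = B.proj := DBunOver.Hom.w k
  have hk' : ∀ i, DBunOver.Hom.hom k ≫ DBunOver.Hom.hom (ρ i) = DBunOver.Hom.hom (π i) :=
    fun i => congrArg DBunOver.Hom.hom (Fan.IsLimit.fac hl (fun i : {i // i ≠ j} => π i) i)
  have hkl : IsLinear P D (DBunOver.Hom.hom k) A.proj := by
    refine hG.isLinear hD ?_ fun i => ?_
    · exact (DBunOver.Hom.w (π j)).trans hk.symm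
    · rw [Category.comp_id]
      exact (hk' i).symm ▸ hP i i.2
  exact ⟨rfl, DBunOver.of D, ρ, hl, hkl.isPullbackBundle (h.isTangentialPullback_of_ne j hG hk hk')⟩

end PartialBundles

/-! ### Affine connections and effective vertical connections -/

section Connections

variable {X : Type u} [Category.{v} X] [TangentCategory X]

variable {E M W A : X} {q : E ⟶ M} {a : W ⟶ E} {b : W ⟶ T.obj M}

/-- The flip turns T(p_E) into p_{TE}, after which naturality of p moves the lift across. -/
theorem DifferentialBundle.image_p_linear (D : DifferentialBundle q) :
    IsLinear D.image D (p E) (p M) where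
  comm := p_natural q
  lift_comp := by
    have hc : c E ≫ T.map (p E) = p (T.obj E) := by
      rw [← Category.comp_id (T.map (p E)), (c_additive E).comm, ← Category.assoc, c_c,
        Category.id_comp]
    change (T.map D.lift ≫ c E) ≫ T.map (p E) = p E ≫ D.lift
    rw [Category.assoc, hc, p_natural]

theorem tangentBundle_map_linear {M N : X} (f : M ⟶ N) :
    IsLinear (tangentBundle M) (tangentBundle N) (T.map f) f where
  comm := (p_natural f).symm
  lift_comp := (ℓ_natural f).symm

theorem DifferentialBundle.μ_comp_map (D : DifferentialBundle q) :
    D.μ ≫ T.map q = (D.pow 2).base ≫ zer M :=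
  mu_comp_map_proj _ _ _ _

/-- K recovers the vertical entry of μ: it is additive for T(σ), it retracts the lift, and it sends
0_E to zero because it is also additive for the tangent bundle of `E`. -/
theorem IsVerticalConnection.μ_comp {D : DifferentialBundle q} {K : T.obj E ⟶ E}
    (hK : IsVerticalConnection D K) : D.μ ≫ K = (D.pow 2).proj 0 := by
  rw [DifferentialBundle.μ, mu]
  refine (hK.linear_image.additive.sum_comp _ _ _).trans ?_
  refine (D.sum_zero_of_eq (n := (D.pow 2).base) ?_ _).trans ?_
  · have hz : zer E ≫ K = q ≫ D.zero := hK.linear_tangent.additive.zero_comp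
    rw [Category.assoc, hz, ← Category.assoc, FibrePower.proj_comp]
  · rw [Category.assoc, hK.retraction, Category.comp_id]

/-- The components of the sum of a vertical and a horizontal element. -/
theorem IsVerticalConnection.sum_components {D : DifferentialBundle q} {K : T.obj E ⟶ E}
    (hK : IsVerticalConnection D K) {H : W ⟶ T.obj E}
    (h₁ : H ≫ T.map q = b) (h₂ : H ≫ K = a ≫ q ≫ D.zero) (g : A ⟶ W) (w u : A ⟶ E)
    (hu : g ≫ a = u) (hw : w ≫ q = u ≫ q)
    (hx : ((D.pow 2).pair w u hw ≫ D.μ) ≫ p E = (g ≫ H) ≫ p E) :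
    (tangentBundle E).sum ((D.pow 2).pair w u hw ≫ D.μ) (g ≫ H) hx ≫ p E = u ∧
    (tangentBundle E).sum ((D.pow 2).pair w u hw ≫ D.μ) (g ≫ H) hx ≫ T.map q = g ≫ b ∧
    (tangentBundle E).sum ((D.pow 2).pair w u hw ≫ D.μ) (g ≫ H) hx ≫ K = w := by
  refine ⟨?_, ?_, ?_⟩
  · rw [AdditiveBundleData.sum_comp, Category.assoc, D.μ_p, FibrePower.pair_snd]
  -- T(q) kills the vertical summand and leaves the T(q)-component of the horizontal one.
  · refine ((tangentBundle_map_linear q).additive.sum_comp _ _ _).trans ?_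
    refine ((tangentBundle M).zero_sum_of_eq (n := u ≫ q) ?_ _).trans ?_
    · rw [Category.assoc, D.μ_comp_map, ← (D.pow 2).proj_comp 1, ← Category.assoc,
        ← Category.assoc, FibrePower.pair_snd]
      rfl
    · rw [Category.assoc, h₁]
  -- K kills the horizontal summand and recovers `w` from the vertical one.
  · refine (hK.linear_tangent.additive.sum_comp _ _ _).trans ?_
    refine (D.sum_zero_of_eq (n := u ≫ q) ?_ _).trans ?_
    · rw [Category.assoc, h₂, ← Category.assoc, hu, Category.assoc]
    · rw [Category.assoc, hK.μ_comp, FibrePower.pair_fst]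

theorem projPair_fst (hW : IsPullback a b q (p M)) : projPair hW ≫ a = p E :=
  hW.lift_fst _ _ _

theorem projPair_snd (hW : IsPullback a b q (p M)) : projPair hW ≫ b = T.map q :=
  hW.lift_snd _ _ _

theorem IsHorizontalConnection.comp_map {D : DifferentialBundle q} {hW : IsPullback a b q (p M)}
    {H : W ⟶ T.obj E} (hH : IsHorizontalConnection D hW H) : H ≫ T.map q = b := by
  rw [← projPair_snd hW, ← Category.assoc, hH.isSection, Category.id_comp]

variable {K : T.obj (T.obj M) ⟶ T.obj M}

/-- The vertical connection of an affine connection is effective. -/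
theorem AffineConnection.isEffective (C : AffineConnection M) :
    IsEffectiveVerticalConnection M C.K := by
  refine ⟨C.vertical, isFibreProduct_iff_isWidePullback.2 ⟨fun j => ?_, fun {A} n e he => ?_,
    fun {A x y} h₀ h₁ => ?_⟩⟩
  · rw [Category.comp_id]
    fin_cases j
    · rfl
    · exact p_natural (p M)
    · exact C.vertical.comp_proj
  · simp only [Category.comp_id] at he
    have hW := ((tangentBundle M).pow 2).isPullback
    have hc : e 0 ≫ p M = e 1 ≫ p M := (he 0).trans (he 1).symm
    have hg₀ := hW.lift_fst (e 0) (e 1) hc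
    have hg₁ := hW.lift_snd (e 0) (e 1) hc
    have hw : e 2 ≫ p M = e 0 ≫ p M := (he 2).trans (he 0).symm
    have hx : (((tangentBundle M).pow 2).pair (e 2) (e 0) hw ≫ (tangentBundle M).μ) ≫ p (T.obj M) =
        (hW.lift (e 0) (e 1) hc ≫ C.H) ≫ p (T.obj M) := by
      rw [Category.assoc, DifferentialBundle.μ_p, FibrePower.pair_snd, Category.assoc,
        C.horizontal.comp_p]
      exact hg₀.symm
    obtain ⟨hx₀, hx₁, hx₂⟩ := C.vertical.sum_components C.horizontal.comp_map C.comp_eq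
      (hW.lift (e 0) (e 1) hc) (e 2) (e 0) hg₀ hw hx
    -- The element with components (e₀, e₁, e₂) is ⟨e₂, e₀⟩μ + ⟨e₀, e₁⟩H.
    refine ⟨(tangentBundle (T.obj M)).sum _ _ hx, ?_, fun j => ?_⟩
    · rw [← Category.assoc, hx₀, he]
    · fin_cases j
      · exact hx₀
      · exact hx₁.trans hg₁
      · exact hx₂
  · have hp : x ≫ p (T.obj M) = y ≫ p (T.obj M) := h₁ 0
    have hq : x ≫ T.map (p M) = y ≫ T.map (p M) := h₁ 1
    have hK : x ≫ C.K = y ≫ C.K := h₁ 2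
    -- By ⟨K, p⟩μ + UH = 1, the morphism x can be rebuilt from x p, x T(p) and x K.
    rw [← Category.comp_id x, ← Category.comp_id y, ← C.sum_eq]
    refine (AdditiveBundleData.comp_sum _ _ _ _ _).trans (Eq.trans
      (AdditiveBundleData.sum_congr _ _ ?_ ?_) (AdditiveBundleData.comp_sum _ _ _ _ _).symm)
    · rw [← Category.assoc, ← Category.assoc]
      refine congrArg (fun z => z ≫ (tangentBundle M).μ) (FibrePower.pair_ext _ ?_ ?_)
      · simpa using hK
      · simpa using hp
    · rw [← Category.assoc, ← Category.assoc]
      refine congrArg (fun z => z ≫ C.H)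
        (((tangentBundle M).pow 2).isPullback.hom_ext ?_ ?_)
      · rw [Category.assoc, Category.assoc, projPair_fst, hp]
      · rw [Category.assoc, Category.assoc, projPair_snd, hq]

/-- Preservation by `T` need not be demanded of an effective connection: T²M is isomorphic to the
specified fibre power T₃M, which is tangential. -/
theorem IsEffectiveVerticalConnection.isTangentialWidePullback
    (hK : IsEffectiveVerticalConnection M K) :
    IsTangentialWidePullback T (𝟙 M) (p M) (p (T.obj M) ≫ p M)
      ![p (T.obj M), T.map (p M), K] :=
  .of_isWidePullback (isFibreProduct_iff_isWidePullback.1 hK.2)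
    ((tangentBundle M).isTangentialWidePullback_pow 3)

theorem IsEffectiveVerticalConnection.hom_ext (hK : IsEffectiveVerticalConnection M K)
    {x y : A ⟶ T.obj (T.obj M)} (h₀ : x ≫ p (T.obj M) = y ≫ p (T.obj M))
    (h₁ : x ≫ T.map (p M) = y ≫ T.map (p M)) (h₂ : x ≫ K = y ≫ K) : x = y := by
  refine hK.isTangentialWidePullback.isWidePullback.hom_ext ?_ fun j => ?_
  · rw [← Category.assoc, h₀, Category.assoc]
  · fin_cases j
    exacts [h₀, h₁, h₂]

/-- This is the test for equations in T³M, such as the linearity of a horizontal connection. -/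
theorem IsEffectiveVerticalConnection.map_hom_ext (hK : IsEffectiveVerticalConnection M K)
    {x y : A ⟶ T.obj (T.obj (T.obj M))} (h₀ : x ≫ T.map (p (T.obj M)) = y ≫ T.map (p (T.obj M)))
    (h₁ : x ≫ T.map (T.map (p M)) = y ≫ T.map (T.map (p M))) (h₂ : x ≫ T.map K = y ≫ T.map K) :
    x = y := by
  refine hK.isTangentialWidePullback.map.hom_ext ?_ fun j => ?_
  · rw [T.map_comp, ← Category.assoc, h₀, Category.assoc]
  · fin_cases j
    exacts [h₀, h₁, h₂]

/-- An affine connection is determined by its vertical connection. -/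
theorem AffineConnection.ext_of_K {C C' : AffineConnection M} (h : C.K = C'.K) : C = C' := by
  have hH : C.H = C'.H := by
    refine C.isEffective.hom_ext ?_ ?_ ?_
    · rw [C.horizontal.comp_p, C'.horizontal.comp_p]
    · rw [C.horizontal.comp_map, C'.horizontal.comp_map]
    · rw [C.comp_eq, h, C'.comp_eq]
  obtain ⟨K, H, _, _, _, _⟩ := C
  obtain ⟨K', H', _, _, _, _⟩ := C'
  obtain rfl : K = K' := h
  obtain rfl : H = H' := hH
  rfl

/-- A section of `U` with vanishing vertical part is a horizontal connection. -/
theorem IsEffectiveVerticalConnection.isHorizontalConnection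
    (hK : IsEffectiveVerticalConnection M K) {H : ((tangentBundle M).pow 2).obj ⟶ T.obj (T.obj M)}
    (h₀ : H ≫ p (T.obj M) = ((tangentBundle M).pow 2).proj 0)
    (h₁ : H ≫ T.map (p M) = ((tangentBundle M).pow 2).proj 1)
    (h₂ : H ≫ K = ((tangentBundle M).pow 2).proj 0 ≫ p M ≫ zer M) :
    IsHorizontalConnection (tangentBundle M) ((tangentBundle M).pow 2).isPullback H := by
  have htan := (tangentBundle M).isTangentialWidePullback_pow 2
  have hv := hK.1
  -- `P` and `R` are the two copies of p_M^*(TM) on T₂M, with projections π₁ and π₂ respectively.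
  obtain ⟨P, hP, hP'⟩ := (tangentBundle M).exists_selfPullback htan 0 1 (by decide)
  obtain ⟨R, hR, hR'⟩ := (tangentBundle M).exists_selfPullback htan 1 0 (by decide)
  -- For the linearity with respect to `R`, the zero vector has to be written through the projection
  -- of `R`, which is π₂.
  have h₂' : H ≫ K = ((tangentBundle M).pow 2).proj 1 ≫ p M ≫ zer M := by
    rw [h₂, ← Category.assoc, ← Category.assoc, FibrePower.proj_comp, FibrePower.proj_comp]
  -- The lift of a zero vector is the zero vector at it, so the K-component of `H` is compatible
  -- with the lifts.
  have hz : ∀ {N : X} (x : N ⟶ T.obj M), (x ≫ p M ≫ zer M) ≫ ℓ M =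
      x ≫ zer (T.obj M) ≫ T.map (p M ≫ zer M) := fun x => by
    rw [Category.assoc, Category.assoc, zer_ℓ, T.map_comp, ← Category.assoc (zer (T.obj M)),
      ← zer_natural (p M), Category.assoc]
  have hRl : R.lift ≫ T.map (((tangentBundle M).pow 2).proj 0) =
    ((tangentBundle M).pow 2).proj 0 ≫ ℓ M := hR.lift_comp
  have hPl : P.lift ≫ T.map (((tangentBundle M).pow 2).proj 1) =
    ((tangentBundle M).pow 2).proj 1 ≫ ℓ M := hP.lift_comp
  have hKt : ℓ (T.obj M) ≫ T.map K = K ≫ ℓ M := hv.linear_tangent.lift_comp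
  have hKi : (tangentBundle M).image.lift ≫ T.map K = K ≫ ℓ M := hv.linear_image.lift_comp
  refine ⟨?_, ⟨P, hP.isPullbackBundle hP'.isTangentialPullback, ?_, ?_⟩,
    ⟨R, hR.isPullbackBundle hR'.isTangentialPullback, ?_, ?_⟩⟩
  · refine ((tangentBundle M).pow 2).isPullback.hom_ext ?_ ?_
    · rw [Category.assoc, projPair_fst, h₀, Category.id_comp]
    · rw [Category.assoc, projPair_snd, h₁, Category.id_comp]
  · rw [Category.comp_id, h₀]
  · change P.lift ≫ T.map H = H ≫ ℓ (T.obj M)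
    refine hK.map_hom_ext ?_ ?_ ?_
    · have hℓ : ℓ (T.obj M) ≫ T.map (p (T.obj M)) = p (T.obj M) ≫ zer (T.obj M) :=
        (tangentBundle (T.obj M)).lift_map_proj
      rw [Category.assoc, Category.assoc, ← T.map_comp, h₀, hℓ, P.lift_map_proj,
        ← Category.assoc, h₀]
    · rw [Category.assoc, Category.assoc, ← T.map_comp, h₁, hPl, ← ℓ_natural, ← Category.assoc,
        h₁]
    · rw [Category.assoc, Category.assoc, ← T.map_comp, hKt, ← Category.assoc H, h₂, hz,
        T.map_comp, ← Category.assoc, P.lift_map_proj, Category.assoc]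
  · exact (Category.comp_id _).trans h₁.symm
  · refine hK.map_hom_ext ?_ ?_ ?_
    · have hℓ : (tangentBundle M).image.lift ≫ T.map (p (T.obj M)) = p (T.obj M) ≫ ℓ M :=
        (tangentBundle M).image_p_linear.lift_comp
      rw [Category.assoc, Category.assoc, ← T.map_comp, h₀, hℓ, hRl, ← Category.assoc, h₀]
    · rw [Category.assoc, Category.assoc, ← T.map_comp, h₁, R.lift_map_proj,
        DifferentialBundle.lift_map_proj, ← Category.assoc, h₁]
    · rw [Category.assoc, Category.assoc, ← T.map_comp, hKi, ← Category.assoc H, h₂', hz,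
        T.map_comp, ← Category.assoc, R.lift_map_proj, Category.assoc]

/-- An effective vertical connection is part of an affine connection. -/
theorem IsEffectiveVerticalConnection.exists_affineConnection
    (hK : IsEffectiveVerticalConnection M K) : ∃ C : AffineConnection M, C.K = K := by
  have hpq : ((tangentBundle M).pow 2).proj 0 ≫ p M = ((tangentBundle M).pow 2).proj 1 ≫ p M :=
    FibrePower.proj_comp_eq _ 0 1
  -- The only candidate for H: the components under p and T(p) make it a section of U, and the
  -- K-component has to vanish.
  obtain ⟨H, -, hH⟩ := hK.isTangentialWidePullback.isWidePullback.exists_lift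
    (((tangentBundle M).pow 2).proj 0 ≫ p M) ![((tangentBundle M).pow 2).proj 0,
      ((tangentBundle M).pow 2).proj 1, ((tangentBundle M).pow 2).proj 0 ≫ p M ≫ zer M] (by
      intro j
      rw [Category.comp_id]
      fin_cases j
      · rfl
      · exact hpq.symm
      · change (_ ≫ p M ≫ zer M) ≫ p M = _
        rw [Category.assoc, Category.assoc, zer_p, Category.comp_id])
  have h₀ : H ≫ p (T.obj M) = ((tangentBundle M).pow 2).proj 0 := hH 0
  have h₁ : H ≫ T.map (p M) = ((tangentBundle M).pow 2).proj 1 := hH 1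
  have h₂ : H ≫ K = ((tangentBundle M).pow 2).proj 0 ≫ p M ≫ zer M := hH 2
  refine ⟨⟨K, H, hK.1, hK.isHorizontalConnection h₀ h₁ h₂, h₂, ?_⟩, rfl⟩
  have hW := ((tangentBundle M).pow 2).isPullback
  obtain ⟨hx₀, hx₁, hx₂⟩ := hK.1.sum_components h₁ h₂ (projPair hW) K (p (T.obj M))
    (projPair_fst hW) hK.1.comp_proj (by
      rw [Category.assoc, DifferentialBundle.μ_p, FibrePower.pair_snd, Category.assoc, h₀]
      exact (projPair_fst hW).symm)
  -- Both sides of ⟨K, p⟩μ + UH = 1 have the components p, T(p) and K.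
  refine hK.hom_ext ?_ ?_ ?_
  · rw [hx₀, Category.id_comp]
  · rw [hx₁, Category.id_comp, projPair_snd]
  · rw [hx₂, Category.id_comp]

/-- For an effective vertical connection `K`, the object `T²M` underlies a biproduct. -/
theorem IsEffectiveVerticalConnection.exists_isBiproduct
    (hK : IsEffectiveVerticalConnection M K) :
    ∃ (r : T.obj (T.obj M) ⟶ M) (F : DifferentialBundle r)
      (π : Fin 3 → (DBunOver.of F ⟶ DBunOver.of (tangentBundle M)))
      (ι : Fin 3 → (DBunOver.of (tangentBundle M) ⟶ DBunOver.of F)),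
      IsBiproduct π ι ∧
      DBunOver.Hom.hom (π 2) = K ∧
      DBunOver.Hom.hom (ι 2) = ℓ M ∧
      IsPartialBundle π 0 (tangentBundle (T.obj M)) ∧
      IsPartialBundle π 1 (tangentBundle M).image := by
  have h := hK.isTangentialWidePullback
  obtain ⟨F, hF⟩ := (tangentBundle M).exists_fibreProduct h
  let π : Fin 3 → (DBunOver.of F ⟶ DBunOver.of (tangentBundle M)) :=
    fun i => (⟨_, hF i⟩ : DBunOver.Hom _ _)
  obtain ⟨ι, hι⟩ := (IsTangentialWidePullback.isProduct (π := π) h).exists_isBiproduct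
  -- The third injection is ℓ_M because both have zero as first and second components and the
  -- identity as third one.
  refine ⟨_, F, π, ι, hι, rfl, hK.hom_ext ?_ ?_ ?_, ?_, ?_⟩
  · exact (congrArg DBunOver.Hom.hom (hι.inj_proj_ne 2 0 (by decide))).trans
      (tangentBundle M).lift_p.symm
  · exact (congrArg DBunOver.Hom.hom (hι.inj_proj_ne 2 1 (by decide))).trans
      (tangentBundle M).lift_map_proj.symm
  · exact (congrArg DBunOver.Hom.hom (hι.inj_proj_self 2)).trans hK.1.retraction.symm
  · refine IsTangentialWidePullback.isPartialBundle (π := π) h 0 _ rfl fun i hi => ?_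
    fin_cases i
    · exact absurd rfl hi
    · exact tangentBundle_map_linear (p M)
    · exact hK.1.linear_tangent
  · refine IsTangentialWidePullback.isPartialBundle (π := π) h 1 _ rfl fun i hi => ?_
    fin_cases i
    · exact (tangentBundle M).image_p_linear
    · exact absurd rfl hi
    · exact hK.1.linear_image

/-- A retraction of the vertical lift that is the third projection of a product with the partial
bundles `T(TM)` is an effective vertical connection. -/
theorem isEffectiveVerticalConnection_of_isProduct (hK : ℓ M ≫ K = 𝟙 (T.obj M))
    {r : T.obj (T.obj M) ⟶ M} {F : DifferentialBundle r}
    {π : Fin 3 → (DBunOver.of F ⟶ DBunOver.of (tangentBundle M))} (h : IsProduct π)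
    (h₂ : DBunOver.Hom.hom (π 2) = K) (hP : IsPartialBundle π 0 (tangentBundle (T.obj M)))
    (hR : IsPartialBundle π 1 (tangentBundle M).image) : IsEffectiveVerticalConnection M K := by
  have hr : p (T.obj M) ≫ p M = r := by
    rw [hP.1]
    exact DBunOver.Hom.w (π 0)
  refine ⟨⟨hK, ?_, ?_⟩, isFibreProduct_iff_isWidePullback.2 ?_⟩
  · exact h₂ ▸ hR.isLinear 2 (by decide)
  · exact h₂ ▸ hP.isLinear 2 (by decide)
  -- The partial bundles identify the first two projections with p_{TM} and T(p_M), as their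
  -- underlying morphisms must be π 0 and π 1.
  · have hπ : (fun j => DBunOver.Hom.hom (π j)) = ![p (T.obj M), T.map (p M), K] := by
      funext j
      fin_cases j
      exacts [hP.1.symm, hR.1.symm, h₂]
    rw [hr, ← hπ]
    exact h.isWidePullback

end Connections

end TangentCat

/-! ### The three bijections -/

theorem mainTheorem6 {X : Type u} [Category.{v} X] [TangentCategory X] (M : X) :
    Set.BijOn (fun C : AffineConnection M => C.K) Set.univ
      {K : T.obj (T.obj M) ⟶ T.obj M |
        ∃ (r : T.obj (T.obj M) ⟶ M) (F : DifferentialBundle r)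
          (π : Fin 3 → (DBunOver.of F ⟶ DBunOver.of (tangentBundle M)))
          (ι : Fin 3 → (DBunOver.of (tangentBundle M) ⟶ DBunOver.of F)),
          IsBiproduct π ι ∧
          DBunOver.Hom.hom (π 2) = K ∧
          DBunOver.Hom.hom (ι 2) = ℓ M ∧
          IsPartialBundle π 0 (tangentBundle (T.obj M)) ∧
          IsPartialBundle π 1 (tangentBundle M).image} ∧
    Set.BijOn (fun C : AffineConnection M => C.K) Set.univ
      {K : T.obj (T.obj M) ⟶ T.obj M |
        ℓ M ≫ K = 𝟙 (T.obj M) ∧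
        ∃ (r : T.obj (T.obj M) ⟶ M) (F : DifferentialBundle r)
          (π : Fin 3 → (DBunOver.of F ⟶ DBunOver.of (tangentBundle M))),
          IsProduct π ∧
          DBunOver.Hom.hom (π 2) = K ∧
          IsPartialBundle π 0 (tangentBundle (T.obj M)) ∧
          IsPartialBundle π 1 (tangentBundle M).image} ∧
    Set.BijOn (fun C : AffineConnection M => C.K) Set.univ
      {K : T.obj (T.obj M) ⟶ T.obj M | IsEffectiveVerticalConnection M K} := by
  -- Bijectivity is settled once for effective vertical connections; what remains is to identify
  -- each of the three sets with them.
  have himage : ∀ S : Set (T.obj (T.obj M) ⟶ T.obj M),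
      (∀ K, K ∈ S ↔ IsEffectiveVerticalConnection M K) →
      Set.BijOn (fun C : AffineConnection M => C.K) Set.univ S := by
    intro S hS
    refine ⟨fun C _ => (hS _).2 C.isEffective, fun _ _ _ _ h => AffineConnection.ext_of_K h,
      fun K hK => ?_⟩
    obtain ⟨C, hC⟩ := ((hS K).1 hK).exists_affineConnection
    exact ⟨C, trivial, hC⟩
  refine ⟨himage _ fun K => ⟨?_, fun hK => hK.exists_isBiproduct⟩,
    himage _ fun K => ⟨?_, fun hK => ?_⟩, himage _ fun K => Iff.rfl⟩
  · rintro ⟨r, F, π, ι, h, h₂, hι, hP, hR⟩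
    -- In a biproduct the retraction is the equation ι₂π₂ = 1, so the first set reduces to the
    -- argument for the second.
    have hK : ℓ M ≫ K = 𝟙 (T.obj M) := by
      rw [← hι, ← h₂]
      exact congrArg DBunOver.Hom.hom (h.inj_proj_self 2)
    exact isEffectiveVerticalConnection_of_isProduct hK h.isProduct h₂ hP hR
  · rintro ⟨hK, r, F, π, h, h₂, hP, hR⟩
    exact isEffectiveVerticalConnection_of_isProduct hK h h₂ hP hR
  · obtain ⟨r, F, π, ι, h, h₂, -, hP, hR⟩ := hK.exists_isBiproduct
    exact ⟨hK.1.retraction, r, F, π, h.isProduct, h₂, hP, hR⟩
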